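/- Let $1\le q\le r$ and $m\ge 1$ be integers, and write $\mathcal X=[0,1]^r$. Let $\mathbb S_m$ be the Sobolev space of functions on $[0,1]$ whose derivatives of order at most $m$ are square integrable, with inner product $$\langle f,g\rangle_{\mathbb S_m}=\sum_{k=0}^{m-1}\int_0^1\!\!\int_0^1 f^{(k)}(x)g^{(k)}(y)\,dx\,dy+\int_0^1 f^{(m)}(x)g^{(m)}(x)\,dx ,$$ and let $\mathbb S_m^{(0)}=\{f\in\mathbb S_m:\int_0^1 f=0\}$. Let $$\mathcal H_q=\bigoplus_{A\subseteq\{1,\dots,r\},\ |A|\le q}\ \bigotimes_{s\in A}\mathbb S_m^{(0)}(x_s)$$ be the orthogonal direct sum of the tensor products (as Hilbert spaces of functions on $\mathcal X$; the summand for $A=\emptyset$ is the space of constants, with norm $|\cdot|$). Fix constants $C>0$, $C_\pi\ge 1$, $\sigma>0$, $C_\sigma>0$, such that some centred Gaussian law of positive variance satisfies the conditions on the noise in (ii) below; equivalently, there is $\tau>0$ with $\tau\le\sigma$, $\tau^2\ge C_\sigma^{-1}$, $\tau^2\le C_\sigma^2$ and $3\tau^4\le C_\sigma^4$. Let $\Omega_m$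 be the set of the joint distributions $\mathbb P_f$ of $(\mathbf X,Y)$ with $Y=f(\mathbf X)+\epsilon$, where $f\in\mathcal H_q$, $\|f\|_{\mathcal H_q}\le C$, and (i) $\mathbf X$ has a density $\pi_{\mathbf X}$ on $\mathcal X$ with $C_\pi^{-1}\le\pi_{\mathbf X}\le C_\pi$; (ii) $\mathbb P(|\epsilon|>t)\le 2\exp\{-t^2/(2\sigma^2)\}$ for all $t>0$ and, almost surely, $\mathbb E(\epsilon\mid\mathbf X)=0$, $\mathbb E(\epsilon^2\mid\mathbf X)\ge C_\sigma^{-1}$, and $\mathbb E(\epsilon^k\mid\mathbf X)\le C_\sigma^k$ for $k=1,2,3,4$. Let $\boldsymbol\beta\in\mathbb N^r$ be such that either $\boldsymbol\beta=0$, in which case put $\beta=0$, or exactly $q$ entries of $\boldsymbol\beta$ are equal to a common $\beta\in\{1,\dots,m-1\}$ and the others are $0$. Then there is a constant $c>0$ not depending on $n$ such that for all $n\ge 1$ $$\inf_{\widehat f}\ \sup_{\mathbb P_f\in\Omega_m}\mathbb E_{\mathbb P_f}\Big(\big\|\partial^{\boldsymbol\beta}\widehat f-\partial^{\boldsymbol\beta}f\big\|_{L_2}^2\Big)\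 \ge\ c\left(\frac{n}{(\log n)^{q-1}}\right)^{-\frac{2(m-\beta)}{2m+1}} ,$$ where $\|g\|_{L_2}^2=\int_{\mathcal X}g^2\,\pi_{\mathbf X}$, the infimum is over all (measurable) estimators based on $n$ independent observations from $\mathbb P_f$, and the right-hand side is read as $0$ when $n=1$ and $q\ge 2$. -/

import Mathlib

open MeasureTheory ProbabilityTheory Filter Topology
open scoped ENNReal

namespace SSANOVA

noncomputable section

/-! ### The univariate Sobolev space on `[0,1]` -/

/-- The `k`-th derivative of a function on `[0,1]` (one-sided at the end points). -/
def D (k : ℕ) (f : ℝ → ℝ) : ℝ → ℝ := iteratedDerivWithin k f (Set.Icc 0 1)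

/-- Membership in the Sobolev space of order `m` on `[0,1]`: the derivatives of order `< m` are
absolutely continuous, and all derivatives of order `≤ m` are square integrable. -/
def MemSobolev (m : ℕ) (f : ℝ → ℝ) : Prop :=
  (∀ k < m, AbsolutelyContinuousOnInterval (D k f) 0 1) ∧
  ∀ k ≤ m, MemLp (D k f) 2 (volume.restrict (Set.Icc (0 : ℝ) 1))

/-- The Sobolev functions on `[0,1]` with integral zero. -/
def MemSobolevZero (m : ℕ) (f : ℝ → ℝ) : Prop :=
  MemSobolev m f ∧ ∫ x in (0 : ℝ)..1, f x = 0

/-- The inner product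
`∑_{k<m} ∫∫ f^{(k)}(x) g^{(k)}(y) dx dy + ∫ f^{(m)}(x) g^{(m)}(x) dx`. -/
def sobolevInner (m : ℕ) (f g : ℝ → ℝ) : ℝ :=
  (∑ k ∈ Finset.range m, ∫ x in (0 : ℝ)..1, ∫ y in (0 : ℝ)..1, D k f x * D k g y)
    + ∫ x in (0 : ℝ)..1, D m f x * D m g x

/-! ### The tensor product space `H_q` on `[0,1]^r` -/

/-- The domain `[0,1]^r`. -/
def cube (r : ℕ) : Set (Fin r → ℝ) := Set.Icc 0 1

/-- An expression `a * ∏_{s ∈ A} g_s(x_s)`. -/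
structure Term (r : ℕ) where
  coeff : ℝ
  supp : Finset (Fin r)
  factor : Fin r → ℝ → ℝ

namespace Term

variable {r : ℕ}

/-- The function on `ℝ^r` given by the expression. -/
def eval (t : Term r) (x : Fin r → ℝ) : ℝ := t.coeff * ∏ s ∈ t.supp, t.factor s (x s)

/-- At most `q` variables occur, and every factor is a Sobolev function with integral zero. -/
def Admissible (m q : ℕ) (t : Term r) : Prop :=
  t.supp.card ≤ q ∧ ∀ s ∈ t.supp, MemSobolevZero m (t.factor s)

/-- The inner product of two elementary tensors: the product of the univariate inner products if
both lie in the same summand `⊗_{s ∈ A} S_m^{(0)}(x_s)`; different summands are orthogonal. -/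
def inner (m : ℕ) (t u : Term r) : ℝ :=
  if t.supp = u.supp then
    t.coeff * u.coeff * ∏ s ∈ t.supp, sobolevInner m (t.factor s) (u.factor s)
  else 0

/-- The negative of an elementary tensor. -/
def neg (t : Term r) : Term r := ⟨-t.coeff, t.supp, t.factor⟩

end Term

/-- The function given by a finite sum of elementary tensors. -/
def sumEval {r : ℕ} (L : List (Term r)) (x : Fin r → ℝ) : ℝ := (L.map fun t => t.eval x).sum

/-- The norm of a finite sum of elementary tensors, by bilinearity of the inner product. -/
def sumNorm {r : ℕ} (m : ℕ) (L : List (Term r)) : ℝ :=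
  Real.sqrt ((L.map fun t => (L.map fun u => t.inner m u).sum).sum)

/-- The difference of two finite sums of elementary tensors. -/
def sumSub {r : ℕ} (L M : List (Term r)) : List (Term r) := L ++ M.map Term.neg

/-- `f ∈ H_q` and `‖f‖_{H_q} = N`: `H_q` is the completion of the finite sums of admissible
elementary tensors, realised as functions on `[0,1]^r`. Thus `f` is on `[0,1]^r` the limit of a
sequence of such sums that is Cauchy in the norm, and `N` is the limit of their norms. -/
def HasHqNorm {r : ℕ} (m q : ℕ) (f : (Fin r → ℝ) → ℝ) (N : ℝ) : Prop :=
  ∃ L : ℕ → List (Term r),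
    (∀ k, ∀ t ∈ L k, t.Admissible m q) ∧
    (∀ ε > 0, ∃ K, ∀ k ≥ K, ∀ l ≥ K, sumNorm m (sumSub (L k) (L l)) < ε) ∧
    (∀ x ∈ cube r, Tendsto (fun k => sumEval (L k) x) atTop (𝓝 (f x))) ∧
    Tendsto (fun k => sumNorm m (L k)) atTop (𝓝 N)

/-! ### Partial derivatives -/

/-- The partial derivative in the `i`-th variable on `[0,1]^r` (one-sided at the boundary). -/
def partialD {r : ℕ} (i : Fin r) (f : (Fin r → ℝ) → ℝ) (x : Fin r → ℝ) : ℝ :=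
  derivWithin (fun t => f (Function.update x i t)) (Set.Icc 0 1) (x i)

/-- `∂^β f = ∂^{|β|} f / ∂x_1^{β_1} … ∂x_r^{β_r}`. -/
def multiD {r : ℕ} (β : Fin r → ℕ) (f : (Fin r → ℝ) → ℝ) : (Fin r → ℝ) → ℝ :=
  (List.finRange r).foldr (fun i g => (partialD i)^[β i] g) f

/-- The derivative orders under consideration: `β = 0`, or exactly `q` entries of `β` are equal to
a common `b ∈ {1, …, m-1}` and the others vanish. -/
def BStar (r m q : ℕ) : Set (Fin r → ℕ) :=
  {β | (∀ i, β i = 0) ∨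
    ∃ b : ℕ, 1 ≤ b ∧ b < m ∧ (∀ i, β i = 0 ∨ β i = b) ∧
      (Finset.univ.filter fun i => 0 < β i).card = q}

/-- The common value of the nonzero entries of `β ∈ BStar r m q` (and `0` for `β = 0`). -/
def order {r : ℕ} (β : Fin r → ℕ) : ℕ := Finset.univ.sup β

/-! ### The regression model -/

/-- The noise `ε = Y - f(X)` on the space of pairs `(X, Y)`. -/
def noise {r : ℕ} (f : (Fin r → ℝ) → ℝ) (z : (Fin r → ℝ) × ℝ) : ℝ := z.2 - f z.1

/-- The σ-algebra generated by `X` on the space of pairs `(X, Y)`. -/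
abbrev sigmaX (r : ℕ) : MeasurableSpace ((Fin r → ℝ) × ℝ) :=
  MeasurableSpace.comap Prod.fst inferInstance

/-- Under the law `P` of `(X, Y)` the design `X` and the noise `ε = Y - f(X)` satisfy the
distributional assumptions with constants `Cπ`, `σ`, `Cσ`. -/
structure DesignNoise {r : ℕ} (Cπ σ Cσ : ℝ) (f : (Fin r → ℝ) → ℝ)
    (P : ProbabilityMeasure ((Fin r → ℝ) × ℝ)) : Prop where
  /-- `X` has a density on `[0,1]^r` with values in `[1/Cπ, Cπ]`. -/
  density : ∃ p : (Fin r → ℝ) → ℝ, Measurable p ∧ (∀ x ∈ cube r, Cπ⁻¹ ≤ p x ∧ p x ≤ Cπ) ∧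
    (P : Measure ((Fin r → ℝ) × ℝ)).map Prod.fst =
      (volume.restrict (cube r)).withDensity fun x => ENNReal.ofReal (p x)
  /-- The noise is sub-Gaussian. -/
  tail : ∀ t > 0, (P : Measure ((Fin r → ℝ) × ℝ)) {z | t < |noise f z|} ≤
    ENNReal.ofReal (2 * Real.exp (-t ^ 2 / (2 * σ ^ 2)))
  /-- `E(ε | X) = 0`. -/
  mean : (P : Measure ((Fin r → ℝ) × ℝ))[noise f | sigmaX r]
    =ᵐ[(P : Measure ((Fin r → ℝ) × ℝ))] 0
  /-- `E(ε² | X) ≥ 1/Cσ`. -/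
  variance : ∀ᵐ z ∂(P : Measure ((Fin r → ℝ) × ℝ)),
    Cσ⁻¹ ≤ ((P : Measure ((Fin r → ℝ) × ℝ))[fun z => noise f z ^ 2 | sigmaX r]) z
  /-- `E(ε^k | X) ≤ Cσ^k` for `k = 1, 2, 3, 4`. -/
  moments : ∀ k ∈ Finset.Icc 1 4, ∀ᵐ z ∂(P : Measure ((Fin r → ℝ) × ℝ)),
    ((P : Measure ((Fin r → ℝ) × ℝ))[fun z => noise f z ^ k | sigmaX r]) z ≤ Cσ ^ k

/-- The class of models `(f, P)`: `P` is the law of `(X, Y)` with `Y = f(X) + ε`, `f ∈ H_q`,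
`‖f‖_{H_q} ≤ C`, and `X`, `ε` satisfy the distributional assumptions. -/
def Model (r m q : ℕ) (C Cπ σ Cσ : ℝ) :
    Set (((Fin r → ℝ) → ℝ) × ProbabilityMeasure ((Fin r → ℝ) × ℝ)) :=
  {M | (∃ N, HasHqNorm m q M.1 N ∧ N ≤ C) ∧ DesignNoise Cπ σ Cσ M.1 M.2}

/-! ### Estimators and the minimax risk -/

/-- A sample of `n` observations `(X_i, Y_i)`. -/
abbrev Sample (r n : ℕ) : Type := Fin n → (Fin r → ℝ) × ℝ

/-- The squared `L_2` norm of `g` with respect to the law of `X` under `P`. -/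
def sqL2 {r : ℕ} (P : ProbabilityMeasure ((Fin r → ℝ) × ℝ)) (g : (Fin r → ℝ) → ℝ) : ℝ≥0∞ :=
  ∫⁻ x, ENNReal.ofReal (g x ^ 2) ∂((P : Measure ((Fin r → ℝ) × ℝ)).map Prod.fst)

/-- `E ‖∂^β f̂ - ∂^β f‖²_{L_2}` for an i.i.d. sample of size `n` from `P`. -/
def risk {r n : ℕ} (β : Fin r → ℕ) (fhat : Sample r n → (Fin r → ℝ) → ℝ)
    (M : ((Fin r → ℝ) → ℝ) × ProbabilityMeasure ((Fin r → ℝ) × ℝ)) : ℝ≥0∞ :=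
  ∫⁻ d, sqL2 M.2 (fun x => multiD β (fhat d) x - multiD β M.1 x)
    ∂(Measure.pi fun _ : Fin n => (M.2 : Measure ((Fin r → ℝ) × ℝ)))

/-- An estimator maps a sample to a function on `[0,1]^r`; the estimate `∂^β f̂` has to depend
measurably on the sample and the point. -/
def IsEstimator {r n : ℕ} (β : Fin r → ℕ) (fhat : Sample r n → (Fin r → ℝ) → ℝ) : Prop :=
  Measurable fun z : Sample r n × (Fin r → ℝ) => multiD β (fhat z.1) z.2

/-- The minimax risk `inf_{f̂} sup_{P_f} E ‖∂^β f̂ - ∂^β f‖²_{L_2}` for `n` observations. -/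
def minimaxRisk {r : ℕ} (m q : ℕ) (C Cπ σ Cσ : ℝ) (β : Fin r → ℕ) (n : ℕ) : ℝ≥0∞ :=
  ⨅ (fhat : Sample r n → (Fin r → ℝ) → ℝ) (_ : IsEstimator β fhat),
    ⨆ M ∈ Model r m q C Cπ σ Cσ, risk β fhat M

end

end SSANOVA

namespace SSANOVA

noncomputable section

/-! ### Trigonometric functions in the Sobolev space -/

/-! The supremum is restricted to uniform design, independent normal noise of variance `τ ^ 2`, and
regression functions `∑ ± a * waveProd A φ ν`, where `A` has `q` coordinates and contains every `i`
with `β i ≠ 0`. Products of waves are orthonormal in `L²`, orthogonal in `H_q` with squared norm `∏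
(2πν_s)^(2m)`, and `∂^β` maps them to multiples of another such orthonormal system. Both the norm
and the multiplier depend on `ν` only through the product of its entries.

Hence all frequencies with product of order `X = 2 ^ k` are on an equal footing. There are at least
`N ≍ X * k ^ (q - 1)` of them, because the exponent `k` can be distributed over `q` coordinates in
about `k ^ (q - 1)` ways (`exists_frequencies`); this is the source of the logarithm. If `n * a ^ 2
≤ τ ^ 2`, flipping one sign leaves the Hellinger affinity of the samples at least `1 / 2`
(`sampleAffinity_ge`), so by `assouad` and Bessel's inequality a fixed part of the total squared
coefficient `N * a ^ 2 * X ^ (2b)` is lost (`minimaxRisk_ge`). The ball of radius `C` allows `a ^ 2`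
of order `1 / (N * X ^ (2m))`.

The two restrictions on `a` balance at `X ^ (2m + 1) ≍ n / (log n) ^ (q - 1)`, where the loss is `X
^ (-2(m - b))`, the claimed rate (`exists_scale_rate`). -/

/-- The cosine wave of frequency `ν` and phase `φ`, normalised in `L²(0,1)`. -/
def wave (ν : ℕ) (φ x : ℝ) : ℝ := √2 * Real.cos (2 * Real.pi * ν * x + φ)

lemma memLp_of_continuous_of_isCompact {X : Type*} [TopologicalSpace X] [T2Space X]
    [MeasurableSpace X] [BorelSpace X] {μ : Measure X} [IsFiniteMeasureOnCompacts μ] {f : X → ℝ}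
    (hf : Continuous f) {K : Set X} (hK : IsCompact K) {p : ℝ≥0∞} : MemLp f p (μ.restrict K) := by
  have : IsFiniteMeasure (μ.restrict K) := ⟨by
    rw [Measure.restrict_apply_univ]
    exact hK.measure_lt_top⟩
  obtain ⟨B, hB⟩ := hK.exists_bound_of_continuousOn hf.continuousOn
  exact MemLp.of_bound hf.aestronglyMeasurable B
    ((ae_restrict_iff' hK.measurableSet).2 (ae_of_all _ hB))

/-- Differentiation only shifts the phase by a quarter turn and rescales. Carrying a phase thus
keeps the family closed under derivatives. -/
lemma hasDerivAt_wave (ν : ℕ) (φ x : ℝ) :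
    HasDerivAt (wave ν φ) (2 * Real.pi * ν * wave ν (φ + Real.pi / 2) x) x := by
  have h : HasDerivAt (fun x : ℝ => 2 * Real.pi * ν * x + φ) (2 * Real.pi * ν) x := by
    simpa using ((hasDerivAt_id x).const_mul (2 * Real.pi * ν)).add_const φ
  convert! h.cos.const_mul √2 using 1
  rw [wave, ← add_assoc, Real.cos_add_pi_div_two]
  ring

@[fun_prop]
lemma continuous_wave (ν : ℕ) (φ : ℝ) : Continuous (wave ν φ) := by
  unfold wave
  fun_prop

lemma contDiff_wave (ν : ℕ) (φ : ℝ) {n : WithTop ℕ∞} : ContDiff ℝ n (wave ν φ) := by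
  unfold wave
  fun_prop

lemma iteratedDeriv_wave (k ν : ℕ) (φ : ℝ) :
    iteratedDeriv k (wave ν φ) =
      fun x => (2 * Real.pi * ν) ^ k * wave ν (φ + k * (Real.pi / 2)) x := by
  induction k with
  | zero => simp
  | succ k ih =>
    rw [iteratedDeriv_succ, ih]
    funext x
    rw [((hasDerivAt_wave ν _ x).const_mul _).deriv]
    push_cast
    rw [show φ + (k + 1) * (Real.pi / 2) = φ + k * (Real.pi / 2) + Real.pi / 2 by ring]
    ring

lemma D_wave (k ν : ℕ) (φ : ℝ) {x : ℝ} (hx : x ∈ Set.Icc (0 : ℝ) 1) :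
    D k (wave ν φ) x = (2 * Real.pi * ν) ^ k * wave ν (φ + k * (Real.pi / 2)) x := by
  rw [D, iteratedDerivWithin_eq_iteratedDeriv (uniqueDiffOn_Icc zero_lt_one)
    (contDiff_wave ν φ).contDiffAt hx, iteratedDeriv_wave]

lemma integral_cos_int (k : ℤ) (hk : k ≠ 0) (φ : ℝ) :
    ∫ x in (0 : ℝ)..1, Real.cos (2 * Real.pi * k * x + φ) = 0 := by
  have hk' : (2 * Real.pi * k : ℝ) ≠ 0 := by
    have : (k : ℝ) ≠ 0 := by exact_mod_cast hk
    positivity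
  rw [intervalIntegral.integral_comp_mul_add (fun x => Real.cos x) hk', integral_cos]
  have : 2 * Real.pi * k * 1 + φ = φ + k * (2 * Real.pi) := by ring
  rw [this, Real.sin_add_int_mul_two_pi]
  simp

lemma integral_wave {ν : ℕ} (hν : 1 ≤ ν) (φ : ℝ) : ∫ x in (0 : ℝ)..1, wave ν φ x = 0 := by
  have := integral_cos_int ν (by positivity) φ
  simp only [wave, intervalIntegral.integral_const_mul]
  simp only [Int.cast_natCast] at this
  rw [this, mul_zero]

/-- By product-to-sum: the term of frequency `ν + μ ≥ 1` integrates to zero for every phase, and in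
the difference term the common phase cancels. -/
lemma integral_wave_mul {ν μ : ℕ} (hν : 1 ≤ ν) (φ : ℝ) :
    ∫ x in (0 : ℝ)..1, wave ν φ x * wave μ φ x = if ν = μ then 1 else 0 := by
  have h : ∀ x, wave ν φ x * wave μ φ x =
      Real.cos (2 * Real.pi * ((ν - μ : ℤ) : ℝ) * x + 0) +
        Real.cos (2 * Real.pi * ((ν + μ : ℤ) : ℝ) * x + (φ + φ)) := by
    intro x
    have h1 : 2 * Real.pi * ((ν - μ : ℤ) : ℝ) * x + 0 =
      (2 * Real.pi * ν * x + φ) - (2 * Real.pi * μ * x + φ) := by push_cast; ring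
    have h2 : 2 * Real.pi * ((ν + μ : ℤ) : ℝ) * x + (φ + φ) =
      (2 * Real.pi * ν * x + φ) + (2 * Real.pi * μ * x + φ) := by push_cast; ring
    rw [h1, h2, Real.cos_sub, Real.cos_add (_ + _) (_ + _), wave, wave]
    linear_combination (Real.cos (2 * Real.pi * ν * x + φ) * Real.cos (2 * Real.pi * μ * x + φ)) *
      Real.mul_self_sqrt (show (0 : ℝ) ≤ 2 by norm_num)
  simp_rw [h]
  rw [intervalIntegral.integral_add (Continuous.intervalIntegrable (by fun_prop) _ _)
    (Continuous.intervalIntegrable (by fun_prop) _ _), integral_cos_int (ν + μ) (by omega),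
    add_zero]
  split_ifs with hνμ
  · simp [hνμ]
  · exact integral_cos_int _ (by omega) _

lemma memSobolev_wave (m ν : ℕ) (φ : ℝ) : MemSobolev m (wave ν φ) := by
  have hD : ∀ k, Set.EqOn (D k (wave ν φ))
      (fun x => (2 * Real.pi * ν) ^ k * wave ν (φ + k * (Real.pi / 2)) x) (Set.Icc 0 1) :=
    fun k x hx => D_wave k ν φ hx
  refine ⟨fun k _ => ?_, fun k _ => ?_⟩
  · have hc : ContDiff ℝ 1 fun x => (2 * Real.pi * ν) ^ k * wave ν (φ + k * (Real.pi / 2)) x :=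
      contDiff_const.mul (contDiff_wave _ _)
    obtain ⟨K, hK⟩ := hc.contDiffOn.exists_lipschitzOnWith one_ne_zero
      (convex_Icc (0 : ℝ) 1) isCompact_Icc
    refine LipschitzOnWith.absolutelyContinuousOnInterval (K := K) ?_
    rw [Set.uIcc_of_le zero_le_one]
    intro x hx y hy
    rw [hD k hx, hD k hy]
    exact hK hx hy
  · refine MemLp.ae_eq (f := fun x => (2 * Real.pi * ν) ^ k * wave ν (φ + k * (Real.pi / 2)) x)
      ?_ ?_
    · exact (ae_restrict_iff' measurableSet_Icc).2 (ae_of_all _ fun x hx => (hD k hx).symm)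
    · exact memLp_of_continuous_of_isCompact (by fun_prop) isCompact_Icc

lemma memSobolevZero_wave (m : ℕ) {ν : ℕ} (hν : 1 ≤ ν) (φ : ℝ) : MemSobolevZero m (wave ν φ) :=
  ⟨memSobolev_wave m ν φ, integral_wave hν φ⟩

/-- The terms of order `k < m` are products of means, and all derivatives of a wave have mean zero.
Only the order `m` term survives. -/
lemma sobolevInner_wave (m : ℕ) {ν μ : ℕ} (hν : 1 ≤ ν) (φ : ℝ) :
    sobolevInner m (wave ν φ) (wave μ φ) = if ν = μ then (2 * Real.pi * ν) ^ (2 * m) else 0 := by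
  have h0 : ∀ k, ∫ x in (0 : ℝ)..1, D k (wave ν φ) x = 0 := by
    intro k
    rw [intervalIntegral.integral_congr (g := fun x => (2 * Real.pi * ν) ^ k *
      wave ν (φ + k * (Real.pi / 2)) x), intervalIntegral.integral_const_mul, integral_wave hν,
      mul_zero]
    intro x hx
    exact D_wave k ν φ (by rwa [Set.uIcc_of_le zero_le_one] at hx)
  rw [sobolevInner, Finset.sum_eq_zero, zero_add]
  · rw [intervalIntegral.integral_congr (g := fun x => ((2 * Real.pi * ν) ^ m *
      (2 * Real.pi * μ) ^ m) * (wave ν (φ + m * (Real.pi / 2)) x *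
        wave μ (φ + m * (Real.pi / 2)) x)), intervalIntegral.integral_const_mul,
      integral_wave_mul hν]
    · split_ifs with h
      · rw [h]; ring
      · simp
    intro x hx
    rw [Set.uIcc_of_le zero_le_one] at hx
    simp only [D_wave _ _ _ hx]
    ring
  · intro k _
    simp_rw [intervalIntegral.integral_const_mul, intervalIntegral.integral_mul_const, h0, zero_mul]

/-! ### Products of waves -/

variable {r : ℕ}

/-- The product of waves in the variables in `A`, with frequencies `ν` and phases `φ`. -/
def waveProd (A : Finset (Fin r)) (φ : Fin r → ℝ) (ν : Fin r → ℕ) (x : Fin r → ℝ) : ℝ :=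
  ∏ s ∈ A, wave (ν s) (φ s) (x s)

@[fun_prop]
lemma continuous_waveProd (A : Finset (Fin r)) (φ : Fin r → ℝ) (ν : Fin r → ℕ) :
    Continuous (waveProd A φ ν) := by
  unfold waveProd
  fun_prop

lemma cube_eq_pi (r : ℕ) : cube r = Set.univ.pi fun _ : Fin r => Set.Icc (0 : ℝ) 1 := by
  rw [Set.pi_univ_Icc]
  rfl

lemma restrict_cube (r : ℕ) : (volume : Measure (Fin r → ℝ)).restrict (cube r) =
    Measure.pi fun _ : Fin r => (volume : Measure ℝ).restrict (Set.Icc 0 1) := by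
  rw [cube_eq_pi, volume_pi, Measure.restrict_pi_pi]

lemma measurableSet_cube (r : ℕ) : MeasurableSet (cube r) := measurableSet_Icc

lemma isCompact_cube (r : ℕ) : IsCompact (cube r) := isCompact_Icc

lemma volume_cube (r : ℕ) : volume (cube r) = 1 := by
  rw [cube_eq_pi, volume_pi_pi]
  simp

instance isProbabilityMeasure_restrict_cube (r : ℕ) :
    IsProbabilityMeasure ((volume : Measure (Fin r → ℝ)).restrict (cube r)) :=
  ⟨by rw [Measure.restrict_apply_univ, volume_cube]⟩

lemma integral_waveProd_mul {A : Finset (Fin r)} (φ : Fin r → ℝ) {ν μ : Fin r → ℕ}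
    (hν : ∀ s ∈ A, 1 ≤ ν s) :
    ∫ x in cube r, waveProd A φ ν x * waveProd A φ μ x =
      if ∀ s ∈ A, ν s = μ s then 1 else 0 := by
  have h : ∀ x : Fin r → ℝ, waveProd A φ ν x * waveProd A φ μ x =
      ∏ s, (if s ∈ A then fun t => wave (ν s) (φ s) t * wave (μ s) (φ s) t else fun _ => 1)
        (x s) := by
    intro x
    rw [waveProd, waveProd, ← Finset.prod_mul_distrib, ← Finset.prod_subset A.subset_univ]
    · exact Finset.prod_congr rfl fun s hs => by simp [hs]
    · exact fun s _ hs => by simp [hs]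
  simp_rw [h]
  rw [restrict_cube, integral_fintype_prod_eq_prod (fun s => (if s ∈ A then fun t =>
    wave (ν s) (φ s) t * wave (μ s) (φ s) t else fun _ => 1))]
  have h1 : ∀ s, ∫ x in Set.Icc (0 : ℝ) 1, (if s ∈ A then fun t =>
      wave (ν s) (φ s) t * wave (μ s) (φ s) t else fun _ => 1) x =
      if s ∈ A → ν s = μ s then 1 else 0 := by
    intro s
    by_cases hs : s ∈ A
    · simp only [hs, if_true, forall_const]
      rw [integral_Icc_eq_integral_Ioc, ← intervalIntegral.integral_of_le zero_le_one,
        integral_wave_mul (hν s hs)]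
    · simp [hs]
  simp_rw [h1]
  rw [Finset.prod_ite_zero]
  simp

/-! ### Linear combinations of products of waves -/

/-- The trigonometric sum with coefficients `c` over the frequencies in `S`. -/
def waveSum (A : Finset (Fin r)) (S : Finset (Fin r → ℕ)) (φ : Fin r → ℝ)
    (c : (Fin r → ℕ) → ℝ) (x : Fin r → ℝ) : ℝ :=
  ∑ ν ∈ S, c ν * waveProd A φ ν x

@[fun_prop]
lemma continuous_waveSum (A : Finset (Fin r)) (S : Finset (Fin r → ℕ)) (φ : Fin r → ℝ)
    (c : (Fin r → ℕ) → ℝ) : Continuous (waveSum A S φ c) := by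
  unfold waveSum
  fun_prop

lemma update_mem_cube {x : Fin r → ℝ} (hx : x ∈ cube r) (i : Fin r) {t : ℝ}
    (ht : t ∈ Set.Icc (0 : ℝ) 1) : Function.update x i t ∈ cube r := by
  rw [cube_eq_pi] at hx ⊢
  intro j _
  rcases eq_or_ne j i with rfl | h
  · simpa using ht
  · simpa [h] using hx j (Set.mem_univ j)

lemma apply_mem_of_mem_cube {x : Fin r → ℝ} (hx : x ∈ cube r) (i : Fin r) :
    x i ∈ Set.Icc (0 : ℝ) 1 := by
  rw [cube_eq_pi] at hx
  exact hx i (Set.mem_univ i)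

/-- One-sided derivatives see only points of the cube, so identities valid on the cube alone can be
differentiated repeatedly. -/
lemma partialD_congr {f g : (Fin r → ℝ) → ℝ} (h : Set.EqOn f g (cube r)) (i : Fin r) :
    Set.EqOn (partialD i f) (partialD i g) (cube r) := fun _ hx =>
  derivWithin_congr (fun _ ht => h (update_mem_cube hx i ht))
    (h (update_mem_cube hx i (apply_mem_of_mem_cube hx i)))

lemma iterate_partialD_congr {f g : (Fin r → ℝ) → ℝ} (h : Set.EqOn f g (cube r)) (i : Fin r)
    (k : ℕ) : Set.EqOn ((partialD i)^[k] f) ((partialD i)^[k] g) (cube r) := by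
  induction k with
  | zero => exact h
  | succ k ih =>
    rw [Function.iterate_succ_apply', Function.iterate_succ_apply']
    exact partialD_congr ih i

lemma hasDerivAt_waveProd_update {A : Finset (Fin r)} {i : Fin r} (hi : i ∈ A) (φ : Fin r → ℝ)
    (ν : Fin r → ℕ) (x : Fin r → ℝ) :
    HasDerivAt (fun t => waveProd A φ ν (Function.update x i t))
      (2 * Real.pi * ν i * waveProd A (Function.update φ i (φ i + Real.pi / 2)) ν x) (x i) := by
  have h1 : (fun t => waveProd A φ ν (Function.update x i t)) =
      fun t => wave (ν i) (φ i) t * ∏ s ∈ A.erase i, wave (ν s) (φ s) (x s) := by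
    funext t
    rw [waveProd, ← Finset.mul_prod_erase _ _ hi, Function.update_self]
    congr 1
    refine Finset.prod_congr rfl fun s hs => ?_
    rw [Function.update_of_ne (Finset.ne_of_mem_erase hs)]
  rw [h1]
  convert! (hasDerivAt_wave (ν i) (φ i) (x i)).mul_const _ using 1
  rw [waveProd, ← Finset.mul_prod_erase _ _ hi, Function.update_self, mul_assoc _ _ (∏ _ ∈ _, _)]
  congr 2
  refine Finset.prod_congr rfl fun s hs => ?_
  rw [Function.update_of_ne (Finset.ne_of_mem_erase hs)]

lemma partialD_waveSum {A : Finset (Fin r)} {i : Fin r} (hi : i ∈ A) (S : Finset (Fin r → ℕ))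
    (φ : Fin r → ℝ) (c : (Fin r → ℕ) → ℝ) :
    Set.EqOn (partialD i (waveSum A S φ c))
      (waveSum A S (Function.update φ i (φ i + Real.pi / 2)) fun ν => c ν * (2 * Real.pi * ν i))
      (cube r) := by
  intro x hx
  have h : HasDerivAt (fun t => waveSum A S φ c (Function.update x i t))
      (∑ ν ∈ S, c ν * (2 * Real.pi * ν i *
        waveProd A (Function.update φ i (φ i + Real.pi / 2)) ν x)) (x i) :=
    HasDerivAt.fun_sum fun ν _ => (hasDerivAt_waveProd_update hi φ ν x).const_mul (c ν)
  rw [partialD, h.hasDerivWithinAt.derivWithin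
    (uniqueDiffOn_Icc zero_lt_one _ (apply_mem_of_mem_cube hx i)), waveSum]
  simp only [mul_assoc]

lemma exists_iterate_partialD_waveSum {A : Finset (Fin r)} {i : Fin r} (φ : Fin r → ℝ) (k : ℕ)
    (hi : k ≠ 0 → i ∈ A) :
    ∃ ψ : Fin r → ℝ, ∀ S c, Set.EqOn ((partialD i)^[k] (waveSum A S φ c))
      (waveSum A S ψ fun ν => c ν * (2 * Real.pi * ν i) ^ k) (cube r) := by
  induction k with
  | zero => exact ⟨φ, fun S c => by simp [Set.eqOn_refl]⟩
  | succ k ih =>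
    have hi := hi k.succ_ne_zero
    obtain ⟨ψ, hψ⟩ := ih fun _ => hi
    refine ⟨Function.update ψ i (ψ i + Real.pi / 2), fun S c => ?_⟩
    rw [Function.iterate_succ_apply']
    refine (partialD_congr (hψ S c) i).trans ((partialD_waveSum hi _ _ _).trans ?_)
    simp only [pow_succ, mul_assoc]
    exact Set.eqOn_refl _ _

/-- Derivatives of trigonometric sums are trigonometric sums; the new phases depend neither on the
frequencies nor on the coefficients. -/
lemma exists_multiD_waveSum {A : Finset (Fin r)} (β : Fin r → ℕ) (hβ : ∀ i, β i ≠ 0 → i ∈ A)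
    (φ : Fin r → ℝ) :
    ∃ ψ : Fin r → ℝ, ∀ S c, Set.EqOn (multiD β (waveSum A S φ c))
      (waveSum A S ψ fun ν => c ν * ∏ i, (2 * Real.pi * ν i) ^ β i) (cube r) := by
  have key : ∀ l : List (Fin r), ∃ ψ : Fin r → ℝ, ∀ S c,
      Set.EqOn (l.foldr (fun i g => (partialD i)^[β i] g) (waveSum A S φ c))
        (waveSum A S ψ fun ν => c ν * (l.map fun i => (2 * Real.pi * ν i) ^ β i).prod)
        (cube r) := by
    intro l
    induction l with
    | nil => exact ⟨φ, fun S c => by simp [Set.eqOn_refl]⟩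
    | cons i l ih =>
      obtain ⟨ψ, hψ⟩ := ih
      obtain ⟨ψ', hψ'⟩ := exists_iterate_partialD_waveSum ψ (β i) (hβ i)
      refine ⟨ψ', fun S c => ?_⟩
      rw [List.foldr_cons]
      refine (iterate_partialD_congr (hψ S c) i (β i)).trans ((hψ' S _).trans ?_)
      simp only [List.map_cons, List.prod_cons, mul_comm, mul_left_comm]
      exact Set.eqOn_refl _ _
  obtain ⟨ψ, hψ⟩ := key (List.finRange r)
  refine ⟨ψ, fun S c => ?_⟩
  simpa only [multiD, ← List.prod_ofFn, List.ofFn_eq_map] using hψ S c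

/-! ### The norm of a trigonometric sum -/

lemma sumNorm_sumSub_self (m : ℕ) (L : List (Term r)) : sumNorm m (sumSub L L) = 0 := by
  have h1 : ∀ t u : Term r, t.inner m u.neg = -t.inner m u := by
    intro t u
    by_cases h : t.supp = u.supp <;> simp [Term.inner, Term.neg, h]
  have h2 : ∀ t : Term r, ∀ L : List (Term r), (L.map fun u => -t.inner m u).sum =
      -(L.map fun u => t.inner m u).sum := by
    intro t L
    induction L with
    | nil => simp
    | cons u L ih => simp [ih, add_comm]
  have h3 : ∀ t : Term r, ((sumSub L L).map fun u => t.inner m u).sum = 0 := by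
    intro t
    simp only [sumSub, List.map_append, List.sum_append, List.map_map, Function.comp_def, h1, h2]
    ring
  simp [sumNorm, h3]

lemma hasHqNorm_waveSum {m q : ℕ} {A : Finset (Fin r)} (hA : A.card ≤ q)
    {S : Finset (Fin r → ℕ)} (hS : ∀ ν ∈ S, ∀ s ∈ A, 1 ≤ ν s)
    (hSA : ∀ ν ∈ S, ∀ s ∉ A, ν s = 0) (φ : Fin r → ℝ) (c : (Fin r → ℕ) → ℝ) :
    HasHqNorm m q (waveSum A S φ c)
      (√(∑ ν ∈ S, c ν ^ 2 * ∏ s ∈ A, (2 * Real.pi * ν s) ^ (2 * m))) := by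
  -- A finite sum of tensors represents itself: a constant sequence is Cauchy because
  -- `sumNorm_sumSub_self` gives distance zero.
  let T : (Fin r → ℕ) → Term r := fun ν => ⟨c ν, A, fun s => wave (ν s) (φ s)⟩
  refine ⟨fun _ => S.toList.map T, ?_, ?_, ?_, ?_⟩
  · intro _ t ht
    obtain ⟨ν, hν, rfl⟩ := List.mem_map.1 ht
    exact ⟨hA, fun s hs => memSobolevZero_wave m (hS ν (Finset.mem_toList.1 hν) s hs) (φ s)⟩
  · intro ε hε
    refine ⟨0, fun _ _ _ _ => ?_⟩
    rwa [sumNorm_sumSub_self]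
  · intro x _
    have : sumEval (S.toList.map T) x = waveSum A S φ c x := by
      rw [sumEval, List.map_map, Finset.sum_map_toList]
      rfl
    simp only [this]
    exact tendsto_const_nhds
  · have : sumNorm m (S.toList.map T) =
        √(∑ ν ∈ S, c ν ^ 2 * ∏ s ∈ A, (2 * Real.pi * ν s) ^ (2 * m)) := by
      rw [sumNorm]
      simp only [List.map_map, Function.comp_def, Finset.sum_map_toList]
      congr 1
      refine Finset.sum_congr rfl fun ν hν => ?_
      rw [Finset.sum_eq_single_of_mem ν hν]
      · simp only [Term.inner, T, if_true]
        rw [← sq]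
        congr 1
        refine Finset.prod_congr rfl fun s hs => ?_
        rw [sobolevInner_wave m (hS ν hν s hs), if_pos rfl]
      -- Distinct frequencies vanishing off `A` differ at some `s ∈ A`, where the univariate inner
      -- product is zero.
      · intro μ hμ hμν
        obtain ⟨s, hs⟩ := Function.ne_iff.1 hμν
        have hsA : s ∈ A := by
          by_contra h
          exact hs ((hSA μ hμ s h).trans (hSA ν hν s h).symm)
        simp only [Term.inner, T, if_true]
        rw [Finset.prod_eq_zero hsA, mul_zero]
        rw [sobolevInner_wave m (hS ν hν s hsA), if_neg (Ne.symm hs)]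
    simp only [this]
    exact tendsto_const_nhds

/-! ### Moments and tails of the normal distribution -/

lemma integral_pow_gaussianReal (v : NNReal) (n : ℕ) :
    ∫ x, x ^ n ∂gaussianReal 0 v = iteratedDeriv n (fun t => Real.exp (v * t ^ 2 / 2)) 0 := by
  have h := iteratedDeriv_mgf_zero (X := id) (μ := gaussianReal 0 v)
    (by rw [integrableExpSet_id_gaussianReal, interior_univ]; trivial) n
  rw [mgf_id_gaussianReal] at h
  simpa using h.symm

/-- Polynomials times the normal moment generating function are closed under differentiation; the
first four moments are then derivatives at `0`. -/
lemma hasDerivAt_mul_exp_mul_sq (v : ℝ) {p : ℝ → ℝ} {p' t : ℝ} (hp : HasDerivAt p p' t) :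
    HasDerivAt (fun t => p t * Real.exp (v * t ^ 2 / 2))
      ((p' + v * t * p t) * Real.exp (v * t ^ 2 / 2)) t := by
  have h : HasDerivAt (fun t : ℝ => v * t ^ 2 / 2) (v * t) t := by
    convert! ((hasDerivAt_pow 2 t).const_mul v).div_const 2 using 1
    push_cast
    ring
  convert! hp.mul h.exp using 1
  ring

lemma moments_gaussianReal (v : NNReal) :
    ∫ x, x ^ 1 ∂gaussianReal 0 v = 0 ∧ ∫ x, x ^ 2 ∂gaussianReal 0 v = v ∧
      ∫ x, x ^ 3 ∂gaussianReal 0 v = 0 ∧ ∫ x, x ^ 4 ∂gaussianReal 0 v = 3 * v ^ 2 := by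
  have hd1 : iteratedDeriv 1 (fun t : ℝ => Real.exp (v * t ^ 2 / 2)) =
      fun t : ℝ => (v * t) * Real.exp (v * t ^ 2 / 2) := by
    rw [iteratedDeriv_one]
    funext t
    have := (hasDerivAt_mul_exp_mul_sq v (hasDerivAt_const t (1 : ℝ))).deriv
    simpa using this
  have hd2 : iteratedDeriv 2 (fun t : ℝ => Real.exp (v * t ^ 2 / 2)) =
      fun t : ℝ => (v + v ^ 2 * t ^ 2) * Real.exp (v * t ^ 2 / 2) := by
    rw [iteratedDeriv_succ, hd1]
    funext t
    rw [(hasDerivAt_mul_exp_mul_sq v ((hasDerivAt_id' t).const_mul (v : ℝ))).deriv]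
    ring
  have hd3 : iteratedDeriv 3 (fun t : ℝ => Real.exp (v * t ^ 2 / 2)) =
      fun t : ℝ => (3 * v ^ 2 * t + v ^ 3 * t ^ 3) * Real.exp (v * t ^ 2 / 2) := by
    rw [iteratedDeriv_succ, hd2]
    funext t
    rw [(hasDerivAt_mul_exp_mul_sq v
      (((hasDerivAt_pow 2 t).const_mul ((v : ℝ) ^ 2)).const_add (v : ℝ))).deriv]
    push_cast
    ring
  have hd4 : iteratedDeriv 4 (fun t : ℝ => Real.exp (v * t ^ 2 / 2)) 0 = 3 * v ^ 2 := by
    rw [iteratedDeriv_succ, hd3]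
    rw [(hasDerivAt_mul_exp_mul_sq v (((hasDerivAt_id' (0 : ℝ)).const_mul (3 * (v : ℝ) ^ 2)).fun_add
      ((hasDerivAt_pow 3 (0 : ℝ)).const_mul ((v : ℝ) ^ 3)))).deriv]
    simp
  refine ⟨?_, ?_, ?_, ?_⟩ <;> rw [integral_pow_gaussianReal]
  · simp [hd1]
  · simp [hd2]
  · simp [hd3]
  · exact hd4

lemma gaussianReal_abs_gt_le (v : NNReal) {t : ℝ} (ht : 0 ≤ t) :
    gaussianReal 0 v {x | t < |x|} ≤ ENNReal.ofReal (2 * Real.exp (-t ^ 2 / (2 * v))) := by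
  have hsub : HasSubgaussianMGF (fun x : ℝ => x) v (gaussianReal 0 v) :=
    ⟨fun t => integrable_exp_mul_gaussianReal t, fun t => by
      rw [mgf_fun_id_gaussianReal]; simp⟩
  have h1 := hsub.measure_ge_le ht
  have h2 := hsub.neg.measure_ge_le ht
  have hss : {x : ℝ | t < |x|} ⊆ {x | t ≤ x} ∪ {x | t ≤ (-fun x : ℝ => x) x} := by
    intro x hx
    rcases lt_abs.1 (show t < |x| from hx) with h | h
    · exact Or.inl h.le
    · exact Or.inr h.le
  refine (measure_mono hss).trans ((measure_union_le _ _).trans ?_)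
  rw [two_mul, ENNReal.ofReal_add (Real.exp_pos _).le (Real.exp_pos _).le]
  exact add_le_add (ENNReal.le_ofReal_iff_toReal_le (measure_ne_top _ _) (Real.exp_pos _).le |>.2 h1)
    (ENNReal.le_ofReal_iff_toReal_le (measure_ne_top _ _) (Real.exp_pos _).le |>.2 h2)

/-! ### Regression with uniform design and normal noise -/

/-- The law of `(X, f(X) + ε)` with `X` uniform on the cube and `ε` independent of `X`, normal with
mean zero and variance `v`. -/
def gaussLaw (f : (Fin r → ℝ) → ℝ) (v : NNReal) : Measure ((Fin r → ℝ) × ℝ) :=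
  ((volume.restrict (cube r)).prod (gaussianReal 0 v)).map fun z => (z.1, f z.1 + z.2)

variable {f : (Fin r → ℝ) → ℝ}

lemma isProbabilityMeasure_gaussLaw (hf : Measurable f) (v : NNReal) :
    IsProbabilityMeasure (gaussLaw f v) :=
  Measure.isProbabilityMeasure_map (by fun_prop)

lemma measurable_noise (hf : Measurable f) : Measurable (noise f) := by
  unfold noise
  fun_prop

/-- Subtracting `f(X)` undoes the construction of `gaussLaw`. Both marginals and the independence of
design and noise follow. -/
lemma map_fst_noise_gaussLaw (hf : Measurable f) (v : NNReal) :
    (gaussLaw f v).map (fun z => (z.1, noise f z)) =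
      (volume.restrict (cube r)).prod (gaussianReal 0 v) := by
  rw [gaussLaw, Measure.map_map (measurable_fst.prodMk (measurable_noise hf)) (by fun_prop)]
  convert Measure.map_id
  funext z
  simp [noise]

lemma map_fst_gaussLaw (hf : Measurable f) (v : NNReal) :
    (gaussLaw f v).map Prod.fst = volume.restrict (cube r) := by
  have h := congrArg (Measure.map Prod.fst) (map_fst_noise_gaussLaw hf v)
  rw [Measure.map_map measurable_fst (measurable_fst.prodMk (measurable_noise hf))] at h
  simpa [Function.comp_def] using h

lemma map_noise_gaussLaw (hf : Measurable f) (v : NNReal) :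
    (gaussLaw f v).map (noise f) = gaussianReal 0 v := by
  have h := congrArg (Measure.map Prod.snd) (map_fst_noise_gaussLaw hf v)
  rw [Measure.map_map measurable_snd (measurable_fst.prodMk (measurable_noise hf))] at h
  simpa [Function.comp_def] using h

lemma condExp_noise_pow (hf : Measurable f) (v : NNReal) (k : ℕ) :
    (gaussLaw f v)[fun z => noise f z ^ k | sigmaX r] =ᵐ[gaussLaw f v]
      fun _ => ∫ x, x ^ k ∂gaussianReal 0 v := by
  have := isProbabilityMeasure_gaussLaw hf v
  have hind : IndepFun Prod.fst (noise f) (gaussLaw f v) := by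
    rw [indepFun_iff_map_prod_eq_prod_map_map measurable_fst.aemeasurable
      (measurable_noise hf).aemeasurable, map_fst_noise_gaussLaw hf, map_fst_gaussLaw hf,
      map_noise_gaussLaw hf]
  have h := condExp_indep_eq (μ := gaussLaw f v) (f := fun z => noise f z ^ k)
    (m₁ := MeasurableSpace.comap (noise f) inferInstance)
    (m₂ := sigmaX r) (measurable_noise hf).comap_le measurable_fst.comap_le
    ((comap_measurable (noise f)).pow_const k).stronglyMeasurable
    ((IndepFun_iff_Indep _ _ _).1 hind.symm)
  rw [← map_noise_gaussLaw hf v, integral_map (measurable_noise hf).aemeasurable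
    (by fun_prop)]
  exact h

lemma designNoise_gaussLaw {Cπ σ Cσ τ : ℝ} (hCπ : 1 ≤ Cπ) (hCσ : 0 < Cσ)
    (hτ : 0 < τ) (hτσ : τ ≤ σ) (h1 : Cσ⁻¹ ≤ τ ^ 2) (h2 : τ ^ 2 ≤ Cσ ^ 2)
    (h4 : 3 * τ ^ 4 ≤ Cσ ^ 4) (hf : Measurable f) :
    DesignNoise Cπ σ Cσ f
      ⟨gaussLaw f (Real.toNNReal (τ ^ 2)), isProbabilityMeasure_gaussLaw hf _⟩ := by
  have hv : ((Real.toNNReal (τ ^ 2) : NNReal) : ℝ) = τ ^ 2 := Real.coe_toNNReal _ (sq_nonneg τ)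
  obtain ⟨m1, m2, m3, m4⟩ := moments_gaussianReal (Real.toNNReal (τ ^ 2))
  rw [hv] at m2 m4
  refine ⟨⟨fun _ => 1, measurable_const, fun x _ => ⟨inv_le_one_of_one_le₀ hCπ, hCπ⟩, ?_⟩,
    ?_, ?_, ?_, ?_⟩
  · rw [ProbabilityMeasure.coe_mk, map_fst_gaussLaw hf]
    simp
  · intro t ht
    rw [ProbabilityMeasure.coe_mk]
    have h : {z | t < |noise f z|} = noise f ⁻¹' {x | t < |x|} := rfl
    rw [h, ← Measure.map_apply (measurable_noise hf)
      (measurableSet_lt measurable_const (by fun_prop)), map_noise_gaussLaw hf]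
    refine (gaussianReal_abs_gt_le _ ht.le).trans (ENNReal.ofReal_le_ofReal ?_)
    rw [hv]
    gcongr 2 * Real.exp ?_
    rw [neg_div, neg_div]
    gcongr
  · have h := condExp_noise_pow hf (Real.toNNReal (τ ^ 2)) 1
    rw [m1] at h
    simp only [pow_one] at h
    exact h
  · filter_upwards [condExp_noise_pow hf (Real.toNNReal (τ ^ 2)) 2] with z hz
    rw [ProbabilityMeasure.coe_mk, hz, m2]
    exact h1
  · intro k hk
    filter_upwards [condExp_noise_pow hf (Real.toNNReal (τ ^ 2)) k] with z hz
    rw [ProbabilityMeasure.coe_mk, hz]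
    rw [Finset.mem_Icc] at hk
    obtain ⟨hk1, hk4⟩ := hk
    interval_cases k
    · rw [m1]; positivity
    · rw [m2]; exact h2
    · rw [m3]; positivity
    · rw [m4]; linarith [h4]

/-- The law of an observation has a density with respect to the uniform law times Lebesgue measure. -/
lemma gaussLaw_eq_withDensity (hf : Measurable f) {v : NNReal} (hv : v ≠ 0) :
    gaussLaw f v = ((volume.restrict (cube r)).prod volume).withDensity
      fun z => gaussianPDF (f z.1) v z.2 := by
  have hm : Measurable fun z : (Fin r → ℝ) × ℝ => gaussianPDF (f z.1) v z.2 :=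
    measurable_uncurry_gaussianPDF.comp
      ((hf.comp measurable_fst).prodMk (measurable_const.prodMk measurable_snd))
  ext s hs
  rw [gaussLaw, Measure.map_apply (by fun_prop) hs, Measure.prod_apply (hs.preimage (by fun_prop)),
    withDensity_apply _ hs, ← lintegral_indicator hs, lintegral_prod _ (by fun_prop)]
  refine lintegral_congr fun x => ?_
  have h := gaussianReal_map_const_add (μ := 0) (v := v) (f x)
  rw [zero_add] at h
  have h1 : Prod.mk x ⁻¹' ((fun z : (Fin r → ℝ) × ℝ => (z.1, f z.1 + z.2)) ⁻¹' s) =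
    (f x + ·) ⁻¹' (Prod.mk x ⁻¹' s) := rfl
  have hs' : MeasurableSet (Prod.mk x ⁻¹' s) := hs.preimage (by fun_prop)
  rw [h1, ← Measure.map_apply (by fun_prop) hs', h, gaussianReal_apply _ hv,
    ← lintegral_indicator hs']
  rfl

/-- Completing the square: `(y-a)² + (y-b)² = 2(y-(a+b)/2)² + (a-b)²/2`. Integrating out `y` leaves
the affinity `exp(-(a-b)²/(8v))`. -/
lemma sqrt_gaussianPDF_mul (a b : ℝ) (v : NNReal) (y : ℝ) :
    (gaussianPDF a v y * gaussianPDF b v y) ^ (1 / 2 : ℝ) =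
      ENNReal.ofReal (Real.exp (-(a - b) ^ 2 / (8 * v))) * gaussianPDF ((a + b) / 2) v y := by
  rw [gaussianPDF, gaussianPDF, gaussianPDF, ← ENNReal.ofReal_mul (gaussianPDFReal_nonneg _ _ _),
    ENNReal.ofReal_rpow_of_nonneg (mul_nonneg (gaussianPDFReal_nonneg _ _ _)
      (gaussianPDFReal_nonneg _ _ _)) (by norm_num), ← ENNReal.ofReal_mul (Real.exp_pos _).le]
  congr 1
  rw [← Real.sqrt_eq_rpow]
  rw [Real.sqrt_eq_iff_mul_self_eq (mul_nonneg (gaussianPDFReal_nonneg _ _ _)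
      (gaussianPDFReal_nonneg _ _ _)) (mul_nonneg (Real.exp_pos _).le
      (gaussianPDFReal_nonneg _ _ _))]
  simp only [gaussianPDFReal]
  have : Real.exp (-(y - a) ^ 2 / (2 * v)) * Real.exp (-(y - b) ^ 2 / (2 * v)) =
      (Real.exp (-(a - b) ^ 2 / (8 * v)) * Real.exp (-(y - (a + b) / 2) ^ 2 / (2 * v))) ^ 2 := by
    rw [← Real.exp_add, ← Real.exp_add, ← Real.exp_nat_mul]
    congr 1
    push_cast
    -- For `v = 0` every exponent is a division by zero, hence `0`, and the identity still holds.
    rcases eq_or_ne (v : ℝ) 0 with h | h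
    · simp [h]
    · field_simp
      ring
  linear_combination ((√(2 * Real.pi * v))⁻¹) ^ 2 * this

/-- The Hellinger affinity of two laws with the same noise is close to one if the regression
functions are close in mean square. -/
lemma affinity_gaussLaw_ge {g : (Fin r → ℝ) → ℝ} (hf : Continuous f) (hg : Continuous g)
    {v : NNReal} (hv : v ≠ 0) :
    ENNReal.ofReal (1 - (∫ x in cube r, (f x - g x) ^ 2) / (8 * v)) ≤
      ∫⁻ z, (gaussianPDF (f z.1) v z.2 * gaussianPDF (g z.1) v z.2) ^ (1 / 2 : ℝ)
        ∂((volume.restrict (cube r)).prod volume) := by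
  have hm : ∀ h : (Fin r → ℝ) → ℝ, Continuous h →
      Measurable fun z : (Fin r → ℝ) × ℝ => gaussianPDF (h z.1) v z.2 := fun h hh =>
    measurable_uncurry_gaussianPDF.comp
      ((hh.measurable.comp measurable_fst).prodMk (measurable_const.prodMk measurable_snd))
  have hfm := hm f hf
  have hgm := hm g hg
  rw [lintegral_prod _ (by fun_prop)]
  simp only [sqrt_gaussianPDF_mul]
  have hcont : Continuous fun x => Real.exp (-(f x - g x) ^ 2 / (8 * v)) := by fun_prop
  have hint : Integrable (fun x => Real.exp (-(f x - g x) ^ 2 / (8 * v)))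
      (volume.restrict (cube r)) :=
    (memLp_of_continuous_of_isCompact (p := 1) hcont (isCompact_cube r)).integrable le_rfl
  have hint2 : Integrable (fun x => (f x - g x) ^ 2) (volume.restrict (cube r)) :=
    (memLp_of_continuous_of_isCompact (p := 1) (by fun_prop) (isCompact_cube r)).integrable le_rfl
  have h1 : ∀ x, ∫⁻ y, ENNReal.ofReal (Real.exp (-(f x - g x) ^ 2 / (8 * v))) *
      gaussianPDF ((f x + g x) / 2) v y =
      ENNReal.ofReal (Real.exp (-(f x - g x) ^ 2 / (8 * v))) := by
    intro x
    rw [lintegral_const_mul _ (measurable_gaussianPDF _ _), lintegral_gaussianPDF_eq_one _ hv,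
      mul_one]
  simp only [h1]
  rw [← ofReal_integral_eq_lintegral_ofReal hint (ae_of_all _ fun x => (Real.exp_pos _).le)]
  refine ENNReal.ofReal_le_ofReal ?_
  have h2 : ∫ x in cube r, (1 - (f x - g x) ^ 2 / (8 * v)) =
      1 - (∫ x in cube r, (f x - g x) ^ 2) / (8 * v) := by
    rw [integral_sub (integrable_const _) (hint2.div_const _), integral_div]
    simp
  rw [← h2]
  refine integral_mono ((integrable_const _).sub (hint2.div_const _)) hint fun x => ?_
  have := Real.add_one_le_exp (-(f x - g x) ^ 2 / (8 * v))
  simp only [neg_div] at this ⊢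
  linarith

/-! ### Densities on product spaces and the two-point method -/

lemma lintegral_pi_prod {E : Type*} [MeasurableSpace E] (μ : Measure E) [SigmaFinite μ] (n : ℕ)
    (f : Fin n → E → ℝ≥0∞) (hf : ∀ i, Measurable (f i)) :
    ∫⁻ x, ∏ i, f i (x i) ∂(Measure.pi fun _ : Fin n => μ) = ∏ i, ∫⁻ x, f i x ∂μ := by
  induction n with
  | zero => simp
  | succ n ih =>
    rw [← ((measurePreserving_piFinSuccAbove (fun _ : Fin (n + 1) => μ) 0).symm).lintegral_comp_emb
      (MeasurableEquiv.measurableEmbedding _)]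
    simp_rw [MeasurableEquiv.piFinSuccAbove_symm_apply, Fin.insertNthEquiv,
      Fin.prod_univ_succ, Fin.insertNth_zero, Equiv.coe_fn_mk, Fin.cons_succ,
      cast_eq, Fin.cons_zero]
    rw [lintegral_prod_mul (f := f 0) (g := fun y : Fin n → E => ∏ i, f i.succ (y i))
      (hf 0).aemeasurable (Finset.measurable_prod _ fun i _ =>
        (hf i.succ).comp (measurable_pi_apply i)).aemeasurable, ih _ fun i => hf i.succ]

lemma pi_withDensity {E : Type*} [MeasurableSpace E] (μ : Measure E) [SigmaFinite μ] (n : ℕ)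
    {p : E → ℝ≥0∞} (hp : Measurable p) [SigmaFinite (μ.withDensity p)] :
    Measure.pi (fun _ : Fin n => μ.withDensity p) =
      (Measure.pi fun _ : Fin n => μ).withDensity fun d => ∏ i, p (d i) := by
  refine Measure.pi_eq fun s hs => ?_
  rw [withDensity_apply _ (MeasurableSet.univ_pi hs), ← lintegral_indicator
    (MeasurableSet.univ_pi hs)]
  have h : ∀ d : Fin n → E, (Set.univ.pi s).indicator (fun d => ∏ i, p (d i)) d =
      ∏ i, (s i).indicator p (d i) := by
    intro d
    by_cases hd : d ∈ Set.univ.pi s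
    · rw [Set.indicator_of_mem hd]
      exact Finset.prod_congr rfl fun i _ => (Set.indicator_of_mem (hd i trivial) p).symm
    · rw [Set.indicator_of_notMem hd]
      simp only [Set.mem_pi, Set.mem_univ, true_implies, not_forall] at hd
      obtain ⟨i, hi⟩ := hd
      exact (Finset.prod_eq_zero (Finset.mem_univ i) (Set.indicator_of_notMem hi p)).symm
  simp_rw [h]
  rw [lintegral_pi_prod μ n _ fun i => hp.indicator (hs i)]
  refine Finset.prod_congr rfl fun i _ => ?_
  rw [withDensity_apply _ (hs i), lintegral_indicator (hs i)]

/-- The affinity is multiplicative over independent observations, which is why it is used here to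
compare samples. -/
lemma affinity_pi {E : Type*} [MeasurableSpace E] (μ : Measure E) [SigmaFinite μ] (n : ℕ)
    {p p' : E → ℝ≥0∞} (hp : Measurable p) (hp' : Measurable p') :
    ∫⁻ d, ((∏ i, p (d i)) * ∏ i, p' (d i)) ^ (1 / 2 : ℝ) ∂(Measure.pi fun _ : Fin n => μ) =
      (∫⁻ z, (p z * p' z) ^ (1 / 2 : ℝ) ∂μ) ^ n := by
  have h : ∀ d : Fin n → E, ((∏ i, p (d i)) * ∏ i, p' (d i)) ^ (1 / 2 : ℝ) =
      ∏ i, (p (d i) * p' (d i)) ^ (1 / 2 : ℝ) := by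
    intro d
    rw [← Finset.prod_mul_distrib, ENNReal.prod_rpow_of_nonneg (by norm_num)]
  simp_rw [h]
  rw [lintegral_pi_prod μ n (fun _ z => (p z * p' z) ^ (1 / 2 : ℝ)) fun _ => by fun_prop]
  simp

lemma ENNReal_add_sq_le (a b : ℝ≥0∞) : (a + b) ^ 2 ≤ 2 * (a ^ 2 + b ^ 2) := by
  rcases eq_or_ne a ⊤ with rfl | ha
  · simp
  rcases eq_or_ne b ⊤ with rfl | hb
  · simp
  lift a to NNReal using ha
  lift b to NNReal using hb
  have h : (a + b) ^ 2 ≤ 2 * (a ^ 2 + b ^ 2) := by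
    rw [← NNReal.coe_le_coe]
    push_cast
    nlinarith [sq_nonneg ((a : ℝ) - b)]
  exact_mod_cast h

/-- The two-point lower bound for the estimation of `± b`, in terms of the Hellinger affinity. -/
lemma two_point_bound {Ω : Type*} [MeasurableSpace Ω] (μ : Measure Ω) {p p' : Ω → ℝ≥0∞}
    (hp : Measurable p) (hp' : Measurable p') (h1 : ∫⁻ z, p z ∂μ ≤ 1) (h1' : ∫⁻ z, p' z ∂μ ≤ 1)
    {g : Ω → ℝ} (hg : Measurable g) (b : ℝ) :
    ENNReal.ofReal (2 * b ^ 2) * (∫⁻ z, (p z * p' z) ^ (1 / 2 : ℝ) ∂μ) ^ 2 ≤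
      ∫⁻ z, ENNReal.ofReal ((g z - b) ^ 2) ∂(μ.withDensity p) +
        ∫⁻ z, ENNReal.ofReal ((g z + b) ^ 2) ∂(μ.withDensity p') := by
  set ρ := ∫⁻ z, (p z * p' z) ^ (1 / 2 : ℝ) ∂μ
  -- Cauchy–Schwarz for the factors `|u| √p` and `√p'`, the second having norm at most one.
  have hCS : ∀ (u : Ω → ℝ) (p p' : Ω → ℝ≥0∞), Measurable u → Measurable p → Measurable p' →
      ∫⁻ z, p' z ∂μ ≤ 1 →
      ∫⁻ z, ENNReal.ofReal |u z| * (p z * p' z) ^ (1 / 2 : ℝ) ∂μ ≤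
        (∫⁻ z, ENNReal.ofReal (u z ^ 2) ∂(μ.withDensity p)) ^ (1 / 2 : ℝ) := by
    intro u p p' hu hp hp' h1
    have hsq : ∀ x : ℝ≥0∞, (x ^ (1 / 2 : ℝ)) ^ (2 : ℝ) = x := by
      intro x
      rw [← ENNReal.rpow_mul]
      norm_num
    calc ∫⁻ z, ENNReal.ofReal |u z| * (p z * p' z) ^ (1 / 2 : ℝ) ∂μ
        = ∫⁻ z, ((fun z => ENNReal.ofReal |u z| * p z ^ (1 / 2 : ℝ)) *
            fun z => p' z ^ (1 / 2 : ℝ)) z ∂μ := by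
          refine lintegral_congr fun z => ?_
          rw [ENNReal.mul_rpow_of_nonneg _ _ (by norm_num), Pi.mul_apply, mul_assoc]
      _ ≤ (∫⁻ z, (ENNReal.ofReal |u z| * p z ^ (1 / 2 : ℝ)) ^ (2 : ℝ) ∂μ) ^ (1 / 2 : ℝ) *
            (∫⁻ z, (p' z ^ (1 / 2 : ℝ)) ^ (2 : ℝ) ∂μ) ^ (1 / 2 : ℝ) :=
          ENNReal.lintegral_mul_le_Lp_mul_Lq μ Real.HolderConjugate.two_two
            (by fun_prop) (by fun_prop)
      _ ≤ (∫⁻ z, (ENNReal.ofReal |u z| * p z ^ (1 / 2 : ℝ)) ^ (2 : ℝ) ∂μ) ^ (1 / 2 : ℝ) * 1 := by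
          gcongr
          simp_rw [hsq]
          exact ENNReal.rpow_le_one h1 (by norm_num)
      _ = _ := by
          rw [mul_one, lintegral_withDensity_eq_lintegral_mul _ hp (by fun_prop)]
          congr 1
          refine lintegral_congr fun z => ?_
          rw [ENNReal.mul_rpow_of_nonneg _ _ (by norm_num), hsq, Pi.mul_apply, mul_comm,
            ENNReal.ofReal_rpow_of_nonneg (abs_nonneg _) (by norm_num)]
          norm_num
  set R := ∫⁻ z, ENNReal.ofReal ((g z - b) ^ 2) ∂(μ.withDensity p)
  set R' := ∫⁻ z, ENNReal.ofReal ((g z + b) ^ 2) ∂(μ.withDensity p')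
  -- The triangle inequality `2|b| ≤ |g - b| + |g + b|` is integrated against `√(p p')`, which
  -- either density can dominate.
  have hle : ENNReal.ofReal (2 * |b|) * ρ ≤ R ^ (1 / 2 : ℝ) + R' ^ (1 / 2 : ℝ) := by
    calc ENNReal.ofReal (2 * |b|) * ρ
        = ∫⁻ z, ENNReal.ofReal (2 * |b|) * (p z * p' z) ^ (1 / 2 : ℝ) ∂μ := by
          rw [lintegral_const_mul _ (by fun_prop)]
      _ ≤ ∫⁻ z, (ENNReal.ofReal |g z - b| * (p z * p' z) ^ (1 / 2 : ℝ) +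
            ENNReal.ofReal |g z + b| * (p' z * p z) ^ (1 / 2 : ℝ)) ∂μ := by
          refine lintegral_mono fun z => ?_
          rw [mul_comm (p' z), ← add_mul, ← ENNReal.ofReal_add (abs_nonneg _) (abs_nonneg _)]
          gcongr
          calc 2 * |b| = |(g z + b) - (g z - b)| := by
                rw [show (g z + b) - (g z - b) = 2 * b by ring, abs_mul, abs_two]
            _ ≤ |g z + b| + |g z - b| := abs_sub _ _
            _ = _ := add_comm _ _
      _ = _ := lintegral_add_left (by fun_prop) _
      _ ≤ _ := add_le_add (hCS _ p p' (by fun_prop) hp hp' h1')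
          (hCS _ p' p (by fun_prop) hp' hp h1)
  have hsq' : ∀ x : ℝ≥0∞, (x ^ (1 / 2 : ℝ)) ^ 2 = x := by
    intro x
    rw [← ENNReal.rpow_natCast, ← ENNReal.rpow_mul]
    norm_num
  have h2 : 2 * (ENNReal.ofReal (2 * b ^ 2) * ρ ^ 2) ≤ 2 * (R + R') := by
    calc 2 * (ENNReal.ofReal (2 * b ^ 2) * ρ ^ 2) = (ENNReal.ofReal (2 * |b|) * ρ) ^ 2 := by
          rw [mul_pow, ← ENNReal.ofReal_pow (by positivity), ← mul_assoc]
          congr 1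
          rw [show (2 : ℝ≥0∞) = ENNReal.ofReal 2 by simp, ← ENNReal.ofReal_mul (by norm_num)]
          congr 1
          rw [mul_pow, sq_abs]
          ring
      _ ≤ (R ^ (1 / 2 : ℝ) + R' ^ (1 / 2 : ℝ)) ^ 2 := by gcongr
      _ ≤ _ := by
          refine (ENNReal_add_sq_le _ _).trans ?_
          rw [hsq', hsq']
  exact (ENNReal.mul_le_mul_iff_right (by norm_num) (by norm_num)).1 h2

/-! ### Bessel's inequality -/

lemma integrable_mul_of_memLp_two {Ω : Type*} [MeasurableSpace Ω] {μ : Measure Ω} {f g : Ω → ℝ}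
    (hf : MemLp f 2 μ) (hg : MemLp g 2 μ) : Integrable (fun x => f x * g x) μ :=
  hf.integrable_mul hg

/-- Expand `0 ≤ ∫ (h - ∑ c_i e_i)²`, where `c_i` are the Fourier coefficients of `h`. -/
lemma sum_sq_integral_mul_le {Ω ι : Type*} [MeasurableSpace Ω] [DecidableEq ι] {μ : Measure Ω}
    {S : Finset ι} {e : ι → Ω → ℝ} (he : ∀ i ∈ S, MemLp (e i) 2 μ)
    (horth : ∀ i ∈ S, ∀ j ∈ S, ∫ x, e i x * e j x ∂μ = if i = j then 1 else 0)
    {h : Ω → ℝ} (hh : MemLp h 2 μ) :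
    ∑ i ∈ S, (∫ x, h x * e i x ∂μ) ^ 2 ≤ ∫ x, h x ^ 2 ∂μ := by
  set c : ι → ℝ := fun i => ∫ x, h x * e i x ∂μ
  have hG : MemLp (fun x => ∑ i ∈ S, c i * e i x) 2 μ :=
    memLp_finsetSum S fun i hi => (he i hi).const_mul (c i)
  have h1 : ∫ x, h x * ∑ i ∈ S, c i * e i x ∂μ = ∑ i ∈ S, c i ^ 2 := by
    simp_rw [Finset.mul_sum]
    rw [integral_finsetSum S fun i hi => integrable_mul_of_memLp_two hh ((he i hi).const_mul (c i))]
    refine Finset.sum_congr rfl fun i _ => ?_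
    rw [show (fun x => h x * (c i * e i x)) = fun x => c i * (h x * e i x) from
      funext fun x => by ring, integral_const_mul, sq]
  have h2 : ∫ x, (∑ i ∈ S, c i * e i x) * ∑ i ∈ S, c i * e i x ∂μ = ∑ i ∈ S, c i ^ 2 := by
    simp_rw [Finset.sum_mul]
    rw [integral_finsetSum S fun i hi => integrable_mul_of_memLp_two ((he i hi).const_mul (c i)) hG]
    refine Finset.sum_congr rfl fun i hi => ?_
    simp_rw [Finset.mul_sum]
    rw [integral_finsetSum S fun j hj =>
      integrable_mul_of_memLp_two ((he i hi).const_mul (c i)) ((he j hj).const_mul (c j))]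
    have hmul : ∀ j, (fun x => c i * e i x * (c j * e j x)) =
        fun x => c i * c j * (e i x * e j x) := fun j => funext fun x => by ring
    rw [Finset.sum_eq_single_of_mem i hi]
    · rw [hmul, integral_const_mul, horth i hi i hi, if_pos rfl, sq, mul_one]
    · intro j hj hji
      rw [hmul, integral_const_mul, horth i hi j hj, if_neg (Ne.symm hji), mul_zero]
  have h3 : 0 ≤ ∫ x, (h x - ∑ i ∈ S, c i * e i x) ^ 2 ∂μ := integral_nonneg fun x => sq_nonneg _
  have hhG := (integrable_mul_of_memLp_two hh hG).const_mul 2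
  have h4 : ∫ x, (h x - ∑ i ∈ S, c i * e i x) ^ 2 ∂μ =
      ∫ x, h x ^ 2 ∂μ - 2 * ∫ x, h x * ∑ i ∈ S, c i * e i x ∂μ +
        ∫ x, (∑ i ∈ S, c i * e i x) * ∑ i ∈ S, c i * e i x ∂μ := by
    have hsub : Integrable (fun x => h x ^ 2 - 2 * (h x * ∑ i ∈ S, c i * e i x)) μ :=
      hh.integrable_sq.sub hhG
    rw [← integral_const_mul, ← integral_sub hh.integrable_sq hhG,
      ← integral_add hsub (integrable_mul_of_memLp_two hG hG)]
    exact integral_congr_ae (ae_of_all _ fun x => by ring)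
  rw [h1, h2] at h4
  linarith

lemma memLp_waveProd (A : Finset (Fin r)) (ψ : Fin r → ℝ) (ν : Fin r → ℕ) :
    MemLp (waveProd A ψ ν) 2 (volume.restrict (cube r)) :=
  memLp_of_continuous_of_isCompact (continuous_waveProd A ψ ν) (isCompact_cube r)

lemma integral_waveProd_mul_of_mem {A : Finset (Fin r)} {S : Finset (Fin r → ℕ)}
    (hS : ∀ ν ∈ S, ∀ s ∈ A, 1 ≤ ν s) (hSA : ∀ ν ∈ S, ∀ s ∉ A, ν s = 0) (ψ : Fin r → ℝ)
    {ν μ : Fin r → ℕ} (hν : ν ∈ S) (hμ : μ ∈ S) :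
    ∫ x in cube r, waveProd A ψ ν x * waveProd A ψ μ x = if ν = μ then 1 else 0 := by
  rw [integral_waveProd_mul ψ (hS ν hν)]
  congr 1
  refine propext ⟨fun h => funext fun s => ?_, fun h s _ => congrFun h s⟩
  by_cases hs : s ∈ A
  · exact h s hs
  · exact (hSA ν hν s hs).trans (hSA μ hμ s hs).symm

/-- The squared distance of `g` to a trigonometric sum is at least the sum of the squared errors of
the Fourier coefficients. -/
lemma sum_sq_coeff_sub_le {A : Finset (Fin r)} {S : Finset (Fin r → ℕ)}
    (hS : ∀ ν ∈ S, ∀ s ∈ A, 1 ≤ ν s) (hSA : ∀ ν ∈ S, ∀ s ∉ A, ν s = 0) (ψ : Fin r → ℝ)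
    {g : (Fin r → ℝ) → ℝ} (hg : Measurable g) (b : (Fin r → ℕ) → ℝ) :
    ∑ ν ∈ S, ENNReal.ofReal (((∫ x in cube r, g x * waveProd A ψ ν x) - b ν) ^ 2) ≤
      ∫⁻ x in cube r, ENNReal.ofReal ((g x - waveSum A S ψ b x) ^ 2) := by
  -- If the distance is infinite, the coefficients of `g` may be default values of a divergent
  -- integral, but the bound is trivial. Otherwise `g - waveSum A S ψ b` is square integrable and
  -- Bessel applies to it.
  rcases eq_or_ne (∫⁻ x in cube r, ENNReal.ofReal ((g x - waveSum A S ψ b x) ^ 2)) ⊤ with h | h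
  · rw [h]
    exact le_top
  have hF : Continuous (waveSum A S ψ b) := continuous_waveSum A S ψ b
  have hFL : MemLp (waveSum A S ψ b) 2 (volume.restrict (cube r)) :=
    memLp_of_continuous_of_isCompact hF (isCompact_cube r)
  have hm : Measurable fun x => g x - waveSum A S ψ b x := hg.sub hF.measurable
  have hint : Integrable (fun x => (g x - waveSum A S ψ b x) ^ 2) (volume.restrict (cube r)) := by
    refine ⟨(hm.pow_const 2).aestronglyMeasurable, ?_⟩
    rw [hasFiniteIntegral_iff_ofReal (ae_of_all _ fun x => sq_nonneg _)]
    exact lt_of_le_of_ne le_top h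
  have hL : MemLp (fun x => g x - waveSum A S ψ b x) 2 (volume.restrict (cube r)) :=
    (memLp_two_iff_integrable_sq hm.aestronglyMeasurable).2 hint
  have hcoef : ∀ ν ∈ S, (∫ x in cube r, g x * waveProd A ψ ν x) - b ν =
      ∫ x in cube r, (g x - waveSum A S ψ b x) * waveProd A ψ ν x := by
    intro ν hν
    have hFν : ∫ x in cube r, waveSum A S ψ b x * waveProd A ψ ν x = b ν := by
      simp only [waveSum, Finset.sum_mul, mul_assoc]
      rw [integral_finsetSum S fun μ _ =>
        (integrable_mul_of_memLp_two (memLp_waveProd A ψ μ) (memLp_waveProd A ψ ν)).const_mul (b μ)]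
      rw [Finset.sum_eq_single_of_mem ν hν]
      · rw [integral_const_mul, integral_waveProd_mul_of_mem hS hSA ψ hν hν, if_pos rfl, mul_one]
      · intro μ hμ hμν
        rw [integral_const_mul, integral_waveProd_mul_of_mem hS hSA ψ hμ hν, if_neg hμν, mul_zero]
    have hsplit : ∫ x in cube r, g x * waveProd A ψ ν x =
        (∫ x in cube r, (g x - waveSum A S ψ b x) * waveProd A ψ ν x) +
          ∫ x in cube r, waveSum A S ψ b x * waveProd A ψ ν x := by
      rw [← integral_add (integrable_mul_of_memLp_two hL (memLp_waveProd A ψ ν))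
        (integrable_mul_of_memLp_two hFL (memLp_waveProd A ψ ν))]
      exact integral_congr_ae (ae_of_all _ fun x => by ring)
    rw [hsplit, hFν, add_sub_cancel_right]
  rw [← ofReal_integral_eq_lintegral_ofReal hint (ae_of_all _ fun x => sq_nonneg _),
    ← ENNReal.ofReal_sum_of_nonneg fun ν _ => sq_nonneg _]
  refine ENNReal.ofReal_le_ofReal ?_
  rw [Finset.sum_congr rfl fun ν hν => by rw [hcoef ν hν]]
  exact sum_sq_integral_mul_le (fun ν _ => memLp_waveProd A ψ ν)
    (fun ν hν μ hμ => integral_waveProd_mul_of_mem hS hSA ψ hν hμ) hL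

/-! ### Assouad's lemma -/

/-- Assouad's lemma for the hypercube of sign vectors, indexed by the sets `T ⊆ S` of positive
signs: the maximal risk is bounded below in terms of the affinities of neighbouring laws. -/
lemma assouad {Ω ι : Type*} [MeasurableSpace Ω] [DecidableEq ι] (μ : Measure Ω) (S : Finset ι)
    {p : Finset ι → Ω → ℝ≥0∞} (hp : ∀ T, Measurable (p T)) (hp1 : ∀ T, ∫⁻ z, p T z ∂μ ≤ 1)
    {κ : ℝ≥0∞} (hκ : ∀ ν ∈ S, ∀ T ⊆ S.erase ν,
      κ ≤ ∫⁻ z, (p (insert ν T) z * p T z) ^ (1 / 2 : ℝ) ∂μ)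
    {g : ι → Ω → ℝ} (hg : ∀ ν, Measurable (g ν)) (b : ι → ℝ) {R : ℝ≥0∞}
    (hR : ∀ T ⊆ S, ∑ ν ∈ S, ∫⁻ z, ENNReal.ofReal ((g ν z - if ν ∈ T then b ν else -b ν) ^ 2)
      ∂(μ.withDensity (p T)) ≤ R) :
    ENNReal.ofReal (∑ ν ∈ S, b ν ^ 2) * κ ^ 2 ≤ R := by
  set F : ι → Finset ι → ℝ≥0∞ := fun ν T =>
    ∫⁻ z, ENNReal.ofReal ((g ν z - if ν ∈ T then b ν else -b ν) ^ 2) ∂(μ.withDensity (p T))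
  have hF : ∀ ν ∈ S, (2 : ℝ≥0∞) ^ S.card * (ENNReal.ofReal (b ν ^ 2) * κ ^ 2) ≤
      ∑ T ∈ S.powerset, F ν T := by
    intro ν hν
    -- The sign vectors are paired by flipping the sign at `ν`; a pair is a two-point problem for `±
    -- b ν`. There are `2 ^ (S.card - 1)` pairs, each contributing a factor `2`.
    have hpair : ∀ T ∈ (S.erase ν).powerset,
        2 * (ENNReal.ofReal (b ν ^ 2) * κ ^ 2) ≤ F ν T + F ν (insert ν T) := by
      intro T hT
      have hT := Finset.mem_powerset.1 hT
      have hνT : ν ∉ T := fun h => Finset.notMem_erase ν S (hT h)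
      have h := two_point_bound μ (hp (insert ν T)) (hp T) (hp1 _) (hp1 _) (hg ν) (b ν)
      have e1 : F ν T = ∫⁻ z, ENNReal.ofReal ((g ν z + b ν) ^ 2) ∂(μ.withDensity (p T)) := by
        simp [F, hνT]
      have e2 : F ν (insert ν T) =
          ∫⁻ z, ENNReal.ofReal ((g ν z - b ν) ^ 2) ∂(μ.withDensity (p (insert ν T))) := by
        simp [F]
      rw [e1, e2, add_comm, ← mul_assoc]
      refine le_trans ?_ h
      rw [ENNReal.ofReal_mul (by norm_num), ENNReal.ofReal_ofNat]
      gcongr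
      exact hκ ν hν T hT
    rw [← Finset.insert_erase hν, Finset.sum_powerset_insert (Finset.notMem_erase ν S),
      ← Finset.sum_add_distrib]
    refine le_trans (le_of_eq ?_) (Finset.sum_le_sum hpair)
    rw [Finset.sum_const, Finset.card_powerset, Finset.card_insert_of_notMem
      (Finset.notMem_erase ν S), nsmul_eq_mul, pow_succ, mul_assoc]
    push_cast
    rfl
  have htot : (2 : ℝ≥0∞) ^ S.card * (ENNReal.ofReal (∑ ν ∈ S, b ν ^ 2) * κ ^ 2) ≤
      (2 : ℝ≥0∞) ^ S.card * R := by
    calc (2 : ℝ≥0∞) ^ S.card * (ENNReal.ofReal (∑ ν ∈ S, b ν ^ 2) * κ ^ 2)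
        = ∑ ν ∈ S, (2 : ℝ≥0∞) ^ S.card * (ENNReal.ofReal (b ν ^ 2) * κ ^ 2) := by
          rw [ENNReal.ofReal_sum_of_nonneg fun ν _ => sq_nonneg _, Finset.sum_mul, Finset.mul_sum]
      _ ≤ ∑ ν ∈ S, ∑ T ∈ S.powerset, F ν T := Finset.sum_le_sum hF
      _ = ∑ T ∈ S.powerset, ∑ ν ∈ S, F ν T := Finset.sum_comm
      _ ≤ ∑ T ∈ S.powerset, R := Finset.sum_le_sum fun T hT => hR T (Finset.mem_powerset.1 hT)
      _ = (2 : ℝ≥0∞) ^ S.card * R := by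
          rw [Finset.sum_const, Finset.card_powerset, nsmul_eq_mul]
          push_cast
          rfl
  exact (ENNReal.mul_le_mul_iff_right (pow_ne_zero _ (by norm_num))
    (ENNReal.pow_ne_top (by norm_num))).1 htot

/-! ### The lower bound for a fixed set of frequencies -/

/-- The coefficients `± a`, positive exactly on `T`. -/
def signCoeff (a : ℝ) (T : Finset (Fin r → ℕ)) (ν : Fin r → ℕ) : ℝ := if ν ∈ T then a else -a

lemma integral_sq_waveSum_signCoeff_sub {A : Finset (Fin r)} {S : Finset (Fin r → ℕ)}
    (hS : ∀ ν ∈ S, ∀ s ∈ A, 1 ≤ ν s) (φ : Fin r → ℝ) (a : ℝ) {ν : Fin r → ℕ} (hν : ν ∈ S)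
    {T : Finset (Fin r → ℕ)} (hT : ν ∉ T) :
    ∫ x in cube r, (waveSum A S φ (signCoeff a (insert ν T)) x -
      waveSum A S φ (signCoeff a T) x) ^ 2 = 4 * a ^ 2 := by
  have h : ∀ x, (waveSum A S φ (signCoeff a (insert ν T)) x -
      waveSum A S φ (signCoeff a T) x) ^ 2 =
        4 * a ^ 2 * (waveProd A φ ν x * waveProd A φ ν x) := by
    intro x
    have : waveSum A S φ (signCoeff a (insert ν T)) x - waveSum A S φ (signCoeff a T) x =
        2 * a * waveProd A φ ν x := by
      rw [waveSum, waveSum, ← Finset.sum_sub_distrib, Finset.sum_eq_single_of_mem ν hν]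
      · simp only [signCoeff, Finset.mem_insert_self, if_true, hT, if_false]
        ring
      · intro μ _ hμ
        simp [signCoeff, hμ]
    rw [this]
    ring
  simp_rw [h]
  rw [integral_const_mul, integral_waveProd_mul φ (hS ν hν)]
  simp

/-- One flipped sign moves the regression function by squared distance `4a²`, so a single affinity
is at least `1 - a²/(2v)`. Bernoulli's inequality turns this into `1 - n a²/(2v) ≥ 1/2` for the
sample. -/
lemma sampleAffinity_ge {A : Finset (Fin r)} {S : Finset (Fin r → ℕ)}
    (hS : ∀ ν ∈ S, ∀ s ∈ A, 1 ≤ ν s) (φ : Fin r → ℝ) {a : ℝ} {v : NNReal} (hv : v ≠ 0) {n : ℕ}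
    (hn : 1 ≤ n) (ha : n * a ^ 2 ≤ v) {ν : Fin r → ℕ} (hν : ν ∈ S)
    {T : Finset (Fin r → ℕ)} (hT : ν ∉ T) :
    ENNReal.ofReal (1 / 2) ≤
      ∫⁻ d, ((∏ i, gaussianPDF (waveSum A S φ (signCoeff a (insert ν T)) (d i).1) v (d i).2) *
        ∏ i, gaussianPDF (waveSum A S φ (signCoeff a T) (d i).1) v (d i).2) ^ (1 / 2 : ℝ)
        ∂(Measure.pi fun _ : Fin n => (volume.restrict (cube r)).prod (volume : Measure ℝ)) := by
  have hm : ∀ c, Measurable fun z : (Fin r → ℝ) × ℝ =>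
      gaussianPDF (waveSum A S φ c z.1) v z.2 := fun c =>
    measurable_uncurry_gaussianPDF.comp
      (((continuous_waveSum A S φ c).measurable.comp measurable_fst).prodMk
        (measurable_const.prodMk measurable_snd))
  rw [affinity_pi ((volume.restrict (cube r)).prod (volume : Measure ℝ)) n (hm _) (hm _)]
  have h1 := affinity_gaussLaw_ge (continuous_waveSum A S φ (signCoeff a (insert ν T)))
    (continuous_waveSum A S φ (signCoeff a T)) hv
  rw [integral_sq_waveSum_signCoeff_sub hS φ a hν hT] at h1
  have hv0 : (0 : ℝ) < v := by positivity
  have hn' : (1 : ℝ) ≤ n := by exact_mod_cast hn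
  have hx : n * (4 * a ^ 2 / (8 * v)) ≤ 1 / 2 := by
    rw [← mul_div_assoc, div_le_iff₀ (by positivity)]
    nlinarith
  have hx0 : 0 ≤ 4 * a ^ 2 / (8 * (v : ℝ)) := by positivity
  have hx1 : 4 * a ^ 2 / (8 * (v : ℝ)) ≤ 1 / 2 :=
    (le_mul_of_one_le_left hx0 hn').trans hx
  refine le_trans ?_ (pow_le_pow_left' h1 n)
  rw [← ENNReal.ofReal_pow (by linarith)]
  refine ENNReal.ofReal_le_ofReal ?_
  have := one_add_mul_le_pow (a := -(4 * a ^ 2 / (8 * (v : ℝ)))) (by linarith) n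
  rw [← sub_eq_add_neg] at this
  linarith

/-- The estimator enters Assouad's lemma only through these Fourier coefficients; joint
measurability in sample and point makes them measurable in the sample. -/
lemma measurable_coeff {n : ℕ} {β : Fin r → ℕ} {fhat : Sample r n → (Fin r → ℝ) → ℝ}
    (hf : IsEstimator β fhat) {e : (Fin r → ℝ) → ℝ} (he : Continuous e) :
    Measurable fun d => ∫ x in cube r, multiD β (fhat d) x * e x := by
  have h : Measurable fun z : Sample r n × (Fin r → ℝ) => multiD β (fhat z.1) z.2 * e z.2 :=
    Measurable.mul hf (he.measurable.comp measurable_snd)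
  exact (h.stronglyMeasurable.integral_prod_right (ν := volume.restrict (cube r))).measurable

/-- The lower bound for the minimax risk given by the sign vectors over the frequencies in `S`. -/
lemma minimaxRisk_ge {m q : ℕ} {C Cπ σ Cσ τ : ℝ} (hC : 0 < C) (hCπ : 1 ≤ Cπ) (hCσ : 0 < Cσ)
    (hτ : 0 < τ) (hτσ : τ ≤ σ) (h1 : Cσ⁻¹ ≤ τ ^ 2) (h2 : τ ^ 2 ≤ Cσ ^ 2)
    (h4 : 3 * τ ^ 4 ≤ Cσ ^ 4) {β : Fin r → ℕ} {A : Finset (Fin r)} (hA : A.card ≤ q)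
    (hβ : ∀ i, β i ≠ 0 → i ∈ A) {S : Finset (Fin r → ℕ)} (hS : ∀ ν ∈ S, ∀ s ∈ A, 1 ≤ ν s)
    (hSA : ∀ ν ∈ S, ∀ s ∉ A, ν s = 0) {n : ℕ} (hn : 1 ≤ n) {a : ℝ} (ha : n * a ^ 2 ≤ τ ^ 2)
    (haC : a ^ 2 * ∑ ν ∈ S, ∏ s ∈ A, (2 * Real.pi * ν s) ^ (2 * m) ≤ C ^ 2) :
    ENNReal.ofReal ((∑ ν ∈ S, (a * ∏ i, (2 * Real.pi * ν i) ^ β i) ^ 2) / 4) ≤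
      minimaxRisk m q C Cπ σ Cσ β n := by
  refine le_iInf₂ fun fhat hfhat => ?_
  set R := ⨆ M ∈ Model r m q C Cπ σ Cσ, risk β fhat M
  set v : NNReal := Real.toNNReal (τ ^ 2)
  have hvτ : (v : ℝ) = τ ^ 2 := Real.coe_toNNReal _ (sq_nonneg τ)
  have hv : v ≠ 0 := by
    have : (0 : ℝ) < v := by rw [hvτ]; positivity
    exact_mod_cast this.ne'
  -- One `ψ` serves all sign vectors, so the derivatives of all candidates are expanded in the same
  -- orthonormal system.
  obtain ⟨ψ, hψ⟩ := exists_multiD_waveSum β hβ 0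
  set f : Finset (Fin r → ℕ) → (Fin r → ℝ) → ℝ := fun T => waveSum A S 0 (signCoeff a T) with hfdef
  have hfc : ∀ T, Continuous (f T) := fun T => continuous_waveSum _ _ _ _
  have hfm : ∀ T, Measurable (f T) := fun T => (hfc T).measurable
  have hprob : ∀ T, IsProbabilityMeasure (gaussLaw (f T) v) := fun T =>
    isProbabilityMeasure_gaussLaw (hfm T) v
  set ν₀ : Measure ((Fin r → ℝ) × ℝ) := (volume.restrict (cube r)).prod volume
  set dens : Finset (Fin r → ℕ) → (Fin r → ℝ) × ℝ → ℝ≥0∞ :=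
    fun T z => gaussianPDF (f T z.1) v z.2
  have hdens : ∀ T, Measurable (dens T) := fun T =>
    measurable_uncurry_gaussianPDF.comp
      (((hfm T).comp measurable_fst).prodMk (measurable_const.prodMk measurable_snd))
  have hlaw : ∀ T, gaussLaw (f T) v = ν₀.withDensity (dens T) := fun T =>
    gaussLaw_eq_withDensity (hfm T) hv
  have hpi : ∀ T, Measure.pi (fun _ : Fin n => gaussLaw (f T) v) =
      (Measure.pi fun _ : Fin n => ν₀).withDensity fun d => ∏ i, dens T (d i) := by
    intro T
    have := hprob T
    rw [hlaw T] at this ⊢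
    exact pi_withDensity ν₀ n (hdens T)
  -- The norm depends on the coefficients only through `a ^ 2`, so the sign pattern is irrelevant
  -- for membership.
  have hmodel : ∀ T, ((f T, ⟨gaussLaw (f T) v, hprob T⟩) :
      ((Fin r → ℝ) → ℝ) × ProbabilityMeasure ((Fin r → ℝ) × ℝ)) ∈
        Model r m q C Cπ σ Cσ := by
    intro T
    refine ⟨⟨_, hasHqNorm_waveSum hA hS hSA 0 (signCoeff a T), ?_⟩,
      designNoise_gaussLaw hCπ hCσ hτ hτσ h1 h2 h4 (hfm T)⟩
    refine Real.sqrt_le_iff.2 ⟨hC.le, ?_⟩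
    refine le_trans (le_of_eq ?_) haC
    rw [Finset.mul_sum]
    refine Finset.sum_congr rfl fun ν _ => ?_
    congr 1
    rw [signCoeff]
    split_ifs <;> ring
  set w : (Fin r → ℕ) → ℝ := fun ν => ∏ i, (2 * Real.pi * ν i) ^ β i
  have key := assouad (Measure.pi fun _ : Fin n => ν₀) S
    (p := fun T d => ∏ i, dens T (d i)) (κ := ENNReal.ofReal (1 / 2))
    (fun T => Finset.measurable_prod _ fun i _ => (hdens T).comp (measurable_pi_apply i))
    (fun T => by
      have := hprob T
      have h := congrArg (fun μ : Measure (Sample r n) => μ Set.univ) (hpi T)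
      simp only [withDensity_apply _ MeasurableSet.univ, Measure.restrict_univ] at h
      rw [← h, measure_univ])
    (fun ν hν T hT => sampleAffinity_ge hS 0 hv hn (by rw [hvτ]; exact ha) hν
      fun h => Finset.notMem_erase ν S (hT h))
    (g := fun ν d => ∫ x in cube r, multiD β (fhat d) x * waveProd A ψ ν x)
    (fun ν => measurable_coeff hfhat (continuous_waveProd A ψ ν))
    (fun ν => a * w ν) (R := R) (fun T _ => by
      rw [← hpi T]
      refine le_trans ?_ (le_iSup₂_of_le _ (hmodel T) le_rfl)
      rw [← lintegral_finsetSum]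
      · refine lintegral_mono fun d => ?_
        rw [sqL2, ProbabilityMeasure.coe_mk, map_fst_gaussLaw (hfm T)]
        have hg : Measurable (multiD β (fhat d)) := hfhat.comp measurable_prodMk_left
        have hB := sum_sq_coeff_sub_le hS hSA ψ hg fun ν => signCoeff a T ν * w ν
        -- The formula for the derivative is known on the cube only, which carries the design.
        have hE : ∫⁻ x in cube r, ENNReal.ofReal ((multiD β (fhat d) x - multiD β (f T) x) ^ 2) =
            ∫⁻ x in cube r, ENNReal.ofReal ((multiD β (fhat d) x -
              waveSum A S ψ (fun ν => signCoeff a T ν * w ν) x) ^ 2) := by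
          refine setLIntegral_congr_fun (measurableSet_cube r) fun x hx => ?_
          simp only [hfdef]
          rw [hψ S (signCoeff a T) hx]
        rw [hE]
        refine le_trans (le_of_eq ?_) hB
        refine Finset.sum_congr rfl fun ν _ => ?_
        congr 3
        simp only [signCoeff]
        split_ifs <;> ring
      · intro ν _
        have := measurable_coeff hfhat (continuous_waveProd A ψ ν)
        fun_prop)
  refine le_trans (le_of_eq ?_) key
  rw [← ENNReal.ofReal_pow (by norm_num), ← ENNReal.ofReal_mul
    (Finset.sum_nonneg fun _ _ => sq_nonneg _)]
  congr 1
  ring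

/-! ### Counting frequencies in a dyadic shell -/

/-- The vectors of positive integers with product of the order `2 ^ k`, taken from the dyadic boxes
with exponents summing to `k`. -/
lemma exists_frequencies {r q : ℕ} {A : Finset (Fin r)} (hA : A.card = q) (hq : 1 ≤ q) (k : ℕ) :
    ∃ S : Finset (Fin r → ℕ), (∀ ν ∈ S, ∀ s ∈ A, 1 ≤ ν s) ∧ (∀ ν ∈ S, ∀ s ∉ A, ν s = 0) ∧
      (∀ ν ∈ S, 2 ^ k ≤ ∏ s ∈ A, ν s ∧ ∏ s ∈ A, ν s ≤ 2 ^ (k + q)) ∧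
      2 ^ k * (k / q + 1) ^ (q - 1) ≤ S.card := by
  obtain ⟨s₀, hs₀⟩ : A.Nonempty := Finset.card_pos.1 (by omega)
  have hcard : (A.erase s₀).card = q - 1 := by rw [Finset.card_erase_of_mem hs₀, hA]
  -- The exponents off `s₀` range freely up to `k / q`. Their sum is at most `(q - 1) * (k / q) ≤
  -- k`, so the natural subtraction defining the exponent at `s₀` is not truncated and all exponents
  -- add up to `k`.
  let E : Finset (Fin r → ℕ) :=
    Fintype.piFinset fun s => if s ∈ A.erase s₀ then Finset.range (k / q + 1) else {0}
  let j : (Fin r → ℕ) → Fin r → ℕ := fun e => Function.update e s₀ (k - ∑ s ∈ A.erase s₀, e s)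
  let box : (Fin r → ℕ) → Finset (Fin r → ℕ) := fun e =>
    Fintype.piFinset fun s => if s ∈ A then Finset.Ico (2 ^ j e s) (2 ^ (j e s + 1)) else {0}
  have hE : ∀ e ∈ E, (∀ s ∈ A.erase s₀, e s ≤ k / q) ∧ ∀ s ∉ A.erase s₀, e s = 0 := by
    intro e he
    rw [Fintype.mem_piFinset] at he
    refine ⟨fun s hs => ?_, fun s hs => ?_⟩
    · have := he s
      rw [if_pos hs, Finset.mem_range] at this
      omega
    · have := he s
      rwa [if_neg hs, Finset.mem_singleton] at this
  have hj : ∀ e, ∀ s ∈ A.erase s₀, j e s = e s := fun e s hs =>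
    Function.update_of_ne (Finset.ne_of_mem_erase hs) _ _
  have hsum : ∀ e ∈ E, ∑ s ∈ A, j e s = k := by
    intro e he
    rw [← Finset.add_sum_erase _ _ hs₀, Finset.sum_congr rfl (hj e)]
    have hle : ∑ s ∈ A.erase s₀, e s ≤ k := by
      calc ∑ s ∈ A.erase s₀, e s ≤ ∑ s ∈ A.erase s₀, k / q := Finset.sum_le_sum (hE e he).1
        _ = (q - 1) * (k / q) := by rw [Finset.sum_const, hcard, smul_eq_mul]
        _ ≤ q * (k / q) := Nat.mul_le_mul_right _ (Nat.sub_le _ _)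
        _ ≤ k := Nat.mul_div_le k q
    simp only [j, Function.update_self]
    exact Nat.sub_add_cancel hle
  have hbox : ∀ e, ∀ ν ∈ box e, (∀ s ∈ A, 2 ^ j e s ≤ ν s ∧ ν s < 2 ^ (j e s + 1)) ∧
      ∀ s ∉ A, ν s = 0 := by
    intro e ν hν
    rw [Fintype.mem_piFinset] at hν
    refine ⟨fun s hs => ?_, fun s hs => ?_⟩
    · have := hν s
      rwa [if_pos hs, Finset.mem_Ico] at this
    · have := hν s
      rwa [if_neg hs, Finset.mem_singleton] at this
  have hboxcard : ∀ e ∈ E, (box e).card = 2 ^ k := by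
    intro e he
    rw [Fintype.card_piFinset, ← Finset.prod_subset A.subset_univ]
    · rw [← hsum e he, ← Finset.prod_pow_eq_pow_sum]
      refine Finset.prod_congr rfl fun s hs => ?_
      rw [if_pos hs, Nat.card_Ico, pow_succ]
      omega
    · intro s _ hs
      rw [if_neg hs, Finset.card_singleton]
  -- The binary logarithm of `ν s` recovers the exponent of the box, so a frequency determines its
  -- box.
  have hdisj : (E : Set (Fin r → ℕ)).PairwiseDisjoint box := by
    intro e he e' he' hne
    rw [Function.onFun, Finset.disjoint_left]
    intro ν hν hν'
    refine hne (funext fun s => ?_)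
    by_cases hs : s ∈ A.erase s₀
    · have hsA := Finset.mem_of_mem_erase hs
      obtain ⟨h1, h2⟩ := (hbox e ν hν).1 s hsA
      obtain ⟨h1', h2'⟩ := (hbox e' ν hν').1 s hsA
      have hl := Nat.log_eq_of_pow_le_of_lt_pow h1 h2
      have hl' := Nat.log_eq_of_pow_le_of_lt_pow h1' h2'
      rw [← hj e s hs, ← hj e' s hs, ← hl, ← hl']
    · rw [(hE e he).2 s hs, (hE e' he').2 s hs]
  refine ⟨E.biUnion box, ?_, ?_, ?_, ?_⟩
  · intro ν hν s hs
    obtain ⟨e, _, hνe⟩ := Finset.mem_biUnion.1 hν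
    exact Nat.one_le_two_pow.trans ((hbox e ν hνe).1 s hs).1
  · intro ν hν s hs
    obtain ⟨e, _, hνe⟩ := Finset.mem_biUnion.1 hν
    exact (hbox e ν hνe).2 s hs
  · intro ν hν
    obtain ⟨e, he, hνe⟩ := Finset.mem_biUnion.1 hν
    constructor
    · rw [← hsum e he, ← Finset.prod_pow_eq_pow_sum]
      exact Finset.prod_le_prod' fun s hs => ((hbox e ν hνe).1 s hs).1
    · have : k + q = ∑ s ∈ A, (j e s + 1) := by
        rw [Finset.sum_add_distrib, hsum e he, Finset.sum_const, hA, smul_eq_mul, mul_one]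
      rw [this, ← Finset.prod_pow_eq_pow_sum]
      exact Finset.prod_le_prod' fun s hs => ((hbox e ν hνe).1 s hs).2.le
  · rw [Finset.card_biUnion hdisj, Finset.sum_congr rfl hboxcard, Finset.sum_const, smul_eq_mul,
      mul_comm]
    refine Nat.mul_le_mul_right _ (le_of_eq ?_)
    rw [Fintype.card_piFinset, ← Finset.prod_subset (A.erase s₀).subset_univ]
    · rw [← hcard, ← Finset.prod_const]
      refine Finset.prod_congr rfl fun s hs => ?_
      rw [if_pos hs, Finset.card_range]
    · intro s _ hs
      rw [if_neg hs, Finset.card_singleton]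

/-! ### The lower bound at a dyadic scale -/

lemma prod_two_pi_mul_pow {r : ℕ} (A : Finset (Fin r)) (ν : Fin r → ℕ) (p : ℕ) :
    ∏ s ∈ A, (2 * Real.pi * ν s) ^ p =
      (2 * Real.pi) ^ (A.card * p) * ((∏ s ∈ A, ν s : ℕ) : ℝ) ^ p := by
  push_cast
  rw [Finset.prod_pow, Finset.prod_mul_distrib, Finset.prod_const, mul_pow, ← pow_mul]

/-- The minimum weighs the two restrictions on the amplitude: its first entry comes from
indistinguishability at sample size `n`, its second from the radius `C`. -/
lemma exists_minimaxRisk_ge_dyadic {r m q : ℕ} (hq : 1 ≤ q) {C Cπ σ Cσ τ : ℝ} (hC : 0 < C)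
    (hCπ : 1 ≤ Cπ) (hCσ : 0 < Cσ) (hτ : 0 < τ) (hτσ : τ ≤ σ) (h1 : Cσ⁻¹ ≤ τ ^ 2)
    (h2 : τ ^ 2 ≤ Cσ ^ 2) (h4 : 3 * τ ^ 4 ≤ Cσ ^ 4) {β : Fin r → ℕ} {A : Finset (Fin r)}
    (hA : A.card = q) {b : ℕ} (hβA : ∀ i ∈ A, β i = b) (hβ : ∀ i ∉ A, β i = 0) :
    ∃ c : ℝ, 0 < c ∧ ∀ n : ℕ, 1 ≤ n → ∀ k : ℕ,
      ENNReal.ofReal (c * (((2 : ℝ) ^ k) ^ (2 * b) *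
        min ((2 : ℝ) ^ k * (((k / q : ℕ) : ℝ) + 1) ^ (q - 1) / n) (1 / ((2 : ℝ) ^ k) ^ (2 * m)))) ≤
        minimaxRisk m q C Cπ σ Cσ β n := by
  have h2pi : 1 ≤ 2 * Real.pi := by linarith [Real.two_le_pi]
  -- The product of the frequencies is at most `2 ^ q * X`, so `W * X ^ (2 * m)` bounds the squared
  -- norm of every product of waves used.
  set W : ℝ := (2 * Real.pi) ^ (q * (2 * m)) * (2 ^ q) ^ (2 * m) with hW
  have hWpos : 0 < W := by positivity
  refine ⟨min (τ ^ 2) (C ^ 2 / W) / 4, by positivity, fun n hn k => ?_⟩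
  obtain ⟨S, hS, hSA, hSprod, hScard⟩ := exists_frequencies hA hq k
  set X : ℝ := 2 ^ k with hX
  have hXpos : 0 < X := by positivity
  have hn0 : (0 : ℝ) < n := by exact_mod_cast hn
  set N : ℝ := (S.card : ℝ)
  have hN : X * (((k / q : ℕ) : ℝ) + 1) ^ (q - 1) ≤ N := by
    have : ((2 ^ k * (k / q + 1) ^ (q - 1) : ℕ) : ℝ) ≤ (S.card : ℝ) := Nat.cast_le.2 hScard
    push_cast at this
    exact this
  have hNpos : 0 < N := lt_of_lt_of_le (by positivity) hN
  -- The largest squared amplitude satisfying both requirements of `minimaxRisk_ge`, up to the bound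
  -- `N * W * X ^ (2 * m)` for the sum.
  set a2 : ℝ := min (τ ^ 2 / n) (C ^ 2 / (N * W * X ^ (2 * m))) with ha2
  have ha2pos : 0 ≤ a2 := by positivity
  have hupper : ∑ ν ∈ S, ∏ s ∈ A, (2 * Real.pi * ν s) ^ (2 * m) ≤ N * W * X ^ (2 * m) := by
    calc ∑ ν ∈ S, ∏ s ∈ A, (2 * Real.pi * ν s) ^ (2 * m) ≤ ∑ ν ∈ S, W * X ^ (2 * m) := by
          refine Finset.sum_le_sum fun ν hν => ?_
          rw [prod_two_pi_mul_pow, hA, hW, mul_assoc, ← mul_pow]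
          gcongr
          have : ((∏ s ∈ A, ν s : ℕ) : ℝ) ≤ ((2 ^ (k + q) : ℕ) : ℝ) := by
            exact_mod_cast (hSprod ν hν).2
          refine this.trans (le_of_eq ?_)
          push_cast
          rw [pow_add, mul_comm]
      _ = N * W * X ^ (2 * m) := by
          rw [Finset.sum_const, nsmul_eq_mul]
          ring
  have hmain := minimaxRisk_ge (m := m) (a := √a2) hC hCπ hCσ hτ hτσ h1 h2 h4 hA.le
    (fun i hi => by by_contra h; exact hi (hβ i h)) hS hSA hn
    (by
      rw [Real.sq_sqrt ha2pos]
      calc n * a2 ≤ n * (τ ^ 2 / n) := by gcongr; exact min_le_left _ _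
        _ = τ ^ 2 := by field_simp)
    (by
      rw [Real.sq_sqrt ha2pos]
      calc a2 * ∑ ν ∈ S, ∏ s ∈ A, (2 * Real.pi * ν s) ^ (2 * m)
          ≤ C ^ 2 / (N * W * X ^ (2 * m)) * (N * W * X ^ (2 * m)) := by
            gcongr
            exact min_le_right _ _
        _ = C ^ 2 := by field_simp)
  refine le_trans (ENNReal.ofReal_le_ofReal ?_) hmain
  have hlower : a2 * (N * X ^ (2 * b)) ≤
      ∑ ν ∈ S, (√a2 * ∏ i, (2 * Real.pi * ν i) ^ β i) ^ 2 := by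
    calc a2 * (N * X ^ (2 * b)) = ∑ ν ∈ S, a2 * X ^ (2 * b) := by
          rw [Finset.sum_const, nsmul_eq_mul]
          ring
      _ ≤ _ := by
          refine Finset.sum_le_sum fun ν hν => ?_
          rw [mul_pow, Real.sq_sqrt ha2pos, mul_comm 2 b, pow_mul]
          gcongr
          rw [← Finset.prod_subset A.subset_univ fun i _ hi => by rw [hβ i hi, pow_zero],
            Finset.prod_congr rfl fun i hi => by rw [hβA i hi], prod_two_pi_mul_pow]
          have h3 : X ≤ ((∏ s ∈ A, ν s : ℕ) : ℝ) := by
            have : ((2 ^ k : ℕ) : ℝ) ≤ ((∏ s ∈ A, ν s : ℕ) : ℝ) := by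
              exact_mod_cast (hSprod ν hν).1
            rw [hX]
            exact_mod_cast this
          calc X ^ b ≤ ((∏ s ∈ A, ν s : ℕ) : ℝ) ^ b := by gcongr
            _ ≤ _ := le_mul_of_one_le_left (by positivity) (one_le_pow₀ h2pi)
  have hmin : min (τ ^ 2) (C ^ 2 / W) *
      min (X * (((k / q : ℕ) : ℝ) + 1) ^ (q - 1) / n) (1 / X ^ (2 * m)) ≤ a2 * N := by
    rw [ha2, min_mul_of_nonneg _ _ hNpos.le]
    refine le_min ?_ ?_
    · calc _ ≤ τ ^ 2 * (X * (((k / q : ℕ) : ℝ) + 1) ^ (q - 1) / n) := by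
            gcongr
            · exact min_le_left _ _
            · exact min_le_left _ _
        _ ≤ τ ^ 2 * (N / n) := by gcongr
        _ = τ ^ 2 / n * N := by ring
    · calc _ ≤ C ^ 2 / W * (1 / X ^ (2 * m)) := by
            gcongr
            · exact min_le_right _ _
            · exact min_le_right _ _
        _ = C ^ 2 / (N * W * X ^ (2 * m)) * N := by field_simp
  calc _ = (min (τ ^ 2) (C ^ 2 / W) *
      min (X * (((k / q : ℕ) : ℝ) + 1) ^ (q - 1) / n) (1 / X ^ (2 * m))) * X ^ (2 * b) / 4 := by
        ring
    _ ≤ (a2 * N) * X ^ (2 * b) / 4 := by gcongr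
    _ ≤ _ := by
        rw [mul_assoc]
        gcongr

/-! ### The choice of the scale -/

/-- Since `log log n = o(log n)`, dividing `n` by a power of `log n` costs at most half of its
logarithm. -/
lemma eventually_log_div_log_pow_ge (p : ℕ) :
    ∀ᶠ n : ℕ in atTop, 1 < Real.log n ∧
      Real.log n / 2 ≤ Real.log ((n : ℝ) / Real.log n ^ p) := by
  have hlog : Tendsto (fun n : ℕ => Real.log n) atTop atTop :=
    Real.tendsto_log_atTop.comp tendsto_natCast_atTop_atTop
  have h := (Real.isLittleO_log_id_atTop.comp_tendsto hlog).bound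
    (show (0 : ℝ) < 1 / (2 * (p + 1)) by positivity)
  filter_upwards [h, hlog.eventually_gt_atTop 1, eventually_gt_atTop 0] with n hn h1 h0
  refine ⟨h1, ?_⟩
  have hn0 : (n : ℝ) ≠ 0 := by positivity
  rw [Real.log_div hn0 (by positivity), Real.log_pow]
  simp only [Function.comp_apply, id, Real.norm_eq_abs] at hn
  rw [abs_of_pos (by linarith : (0 : ℝ) < Real.log n)] at hn
  have h2 : Real.log (Real.log n) ≤ 1 / (2 * (p + 1)) * Real.log n := (le_abs_self _).trans hn
  have h3 : p * Real.log (Real.log n) ≤ p * (1 / (2 * (p + 1)) * Real.log n) := by gcongr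
  have h4 : (p : ℝ) * (1 / (2 * (p + 1)) * Real.log n) ≤ Real.log n / 2 := by
    have : (p : ℝ) * (1 / (2 * (p + 1))) ≤ 1 / 2 := by
      rw [mul_one_div, div_le_div_iff₀ (by positivity) (by norm_num)]
      linarith
    nlinarith
  linarith

/-- Rounds `u ^ (1 / d)` down to a power of two. The bound on `log u` says that `k` is at least of
order `log u`, which converts powers of `k` into powers of `log n`. -/
lemma exists_pow_two_pow_le (d : ℕ) (hd : 0 < d) {u : ℝ} (hu : 1 ≤ u) :
    ∃ k : ℕ, ((2 : ℝ) ^ k) ^ d ≤ u ∧ u ≤ ((2 : ℝ) ^ (k + 1)) ^ d ∧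
      Real.log u ≤ d * (k + 1) := by
  have h : (1 : ℝ) < 2 ^ d := one_lt_pow₀ (by norm_num) hd.ne'
  obtain ⟨k, hk1, hk2⟩ := exists_nat_pow_near hu h
  have e : ∀ j : ℕ, ((2 : ℝ) ^ d) ^ j = ((2 : ℝ) ^ j) ^ d := fun j => by
    rw [← pow_mul, ← pow_mul, mul_comm]
  rw [e] at hk1 hk2
  refine ⟨k, hk1, hk2.le, ?_⟩
  have h1 := Real.log_le_log (by linarith) hk2.le
  rw [Real.log_pow, Real.log_pow] at h1
  have h2 : Real.log 2 ≤ 1 := by linarith [Real.log_two_lt_d9]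
  calc Real.log u ≤ d * (((k + 1 : ℕ) : ℝ) * Real.log 2) := h1
    _ ≤ d * (((k + 1 : ℕ) : ℝ) * 1) := by gcongr
    _ = d * (k + 1) := by push_cast; ring

/-- For large `n` the dyadic scale can be chosen such that the lower bound is of the order of
`(n / (log n) ^ (q - 1)) ^ (-2(m-b)/(2m+1))`. -/
lemma exists_scale_rate {q m b : ℕ} (hq : 1 ≤ q) (hb : b < m) :
    ∃ c : ℝ, 0 < c ∧ ∀ᶠ n : ℕ in atTop, ∃ k : ℕ,
      c * ((n : ℝ) / Real.log n ^ (q - 1)) ^ (-(2 * ((m : ℝ) - b) / (2 * m + 1))) ≤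
        ((2 : ℝ) ^ k) ^ (2 * b) *
          min ((2 : ℝ) ^ k * (((k / q : ℕ) : ℝ) + 1) ^ (q - 1) / n)
            (1 / ((2 : ℝ) ^ k) ^ (2 * m)) := by
  set d : ℕ := 2 * m + 1 with hd
  -- `1 / 2 ^ d` pays for the dyadic rounding, and `1 / (2 * d * q)` for comparing `k / q + 1` with
  -- `log n`.
  set c : ℝ := (1 / 2 ^ d) * (1 / (2 * d * q)) ^ (q - 1) with hc
  have hq1 : (1 : ℝ) ≤ q := by exact_mod_cast hq
  have hd1 : (1 : ℝ) ≤ d := by exact_mod_cast (by omega : 1 ≤ d)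
  have hcpos : 0 < c := by positivity
  have hc1 : c ≤ 1 := by
    refine mul_le_one₀ ?_ (by positivity) (pow_le_one₀ (by positivity) ?_)
    · rw [div_le_one (by positivity)]
      exact one_le_pow₀ (by norm_num)
    · rw [div_le_one (by positivity)]
      nlinarith
  refine ⟨c, hcpos, ?_⟩
  filter_upwards [eventually_log_div_log_pow_ge (q - 1), eventually_gt_atTop 0] with n hn hn0
  obtain ⟨hlog, hlogu⟩ := hn
  have hn0' : (0 : ℝ) < n := by exact_mod_cast hn0
  have hlogp : 0 < Real.log n ^ (q - 1) := by positivity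
  set u : ℝ := (n : ℝ) / Real.log n ^ (q - 1) with hu
  have hupos : 0 < u := by positivity
  have hu1 : 1 ≤ u := by
    rw [← Real.log_nonneg_iff hupos]
    linarith
  obtain ⟨k, hk1, hk2, hk3⟩ := exists_pow_two_pow_le d (by omega) hu1
  refine ⟨k, ?_⟩
  set X : ℝ := 2 ^ k with hX
  have hXpos : 0 < X := by positivity
  set γ : ℝ := 2 * ((m : ℝ) - b) / (2 * m + 1) with hγ
  have hmb : (b : ℝ) < m := by exact_mod_cast hb
  have hγpos : 0 < γ := by
    have : 0 < (m : ℝ) - b := by linarith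
    positivity
  -- `X ^ (2m + 1) ≤ u`, and raising to the power `-γ` reverses the inequality and gives `X ^ (-2(m
  -- - b))`.
  have hbias : u ^ (-γ) ≤ X ^ (2 * b) * (1 / X ^ (2 * m)) := by
    calc u ^ (-γ) ≤ (X ^ d) ^ (-γ) :=
          Real.rpow_le_rpow_of_nonpos (by positivity) hk1 (by linarith)
      _ = X ^ (2 * b) * (1 / X ^ (2 * m)) := by
          rw [← Real.rpow_natCast X d, ← Real.rpow_mul hXpos.le, mul_one_div,
            ← Real.rpow_natCast X (2 * b), ← Real.rpow_natCast X (2 * m), ← Real.rpow_sub hXpos]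
          congr 1
          rw [hγ, hd]
          push_cast
          field_simp
          ring
  -- At this scale the sample-size entry of the minimum is at least `c` times the radius entry.
  have hcount : c * (n : ℝ) ≤ X ^ d * (((k / q : ℕ) : ℝ) + 1) ^ (q - 1) := by
    have hk4 : ((k : ℝ) + 1) / q ≤ ((k / q : ℕ) : ℝ) + 1 := by
      rw [div_le_iff₀ (by linarith)]
      have : k + 1 ≤ (k / q + 1) * q := by
        have := Nat.lt_div_mul_add (a := k) (b := q) (by omega)
        rw [add_mul, one_mul]
        omega
      exact_mod_cast this
    have hk5 : Real.log n / (2 * d * q) ≤ ((k / q : ℕ) : ℝ) + 1 := by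
      refine le_trans ?_ hk4
      rw [div_le_div_iff₀ (by positivity) (by positivity)]
      nlinarith
    have h2d : (1 / 2 ^ d) * u ≤ X ^ d := by
      rw [one_div_mul_eq_div, div_le_iff₀ (by positivity)]
      rwa [pow_succ 2 k, mul_pow] at hk2
    calc c * (n : ℝ) = ((1 / 2 ^ d) * u) * (Real.log n / (2 * d * q)) ^ (q - 1) := by
          rw [hc, hu, div_pow, div_pow, one_pow]
          field_simp
      _ ≤ _ := by gcongr
  rw [mul_min_of_nonneg _ _ (by positivity)]
  refine le_min ?_ ?_
  · calc c * u ^ (-γ) ≤ c * (X ^ (2 * b) * (1 / X ^ (2 * m))) := by gcongr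
      _ = (c * n) * (X ^ (2 * b) / X ^ (2 * m) / n) := by field_simp
      _ ≤ (X ^ d * (((k / q : ℕ) : ℝ) + 1) ^ (q - 1)) * (X ^ (2 * b) / X ^ (2 * m) / n) := by
          gcongr
      _ = _ := by
          rw [hd, pow_succ X (2 * m)]
          field_simp
  · calc c * u ^ (-γ) ≤ 1 * u ^ (-γ) := by gcongr
      _ ≤ _ := by rwa [one_mul]

/-- Only finitely many `n` are exceptional, so the constant can be shrunk to cover them. -/
lemma exists_const_forall_of_eventually {P : ℝ → ℕ → Prop}
    (hmono : ∀ c c' n, 0 < c' → c' ≤ c → P c n → P c' n) (hpt : ∀ n, ∃ c, 0 < c ∧ P c n)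
    (hev : ∃ c, 0 < c ∧ ∀ᶠ n in atTop, P c n) : ∃ c, 0 < c ∧ ∀ n, P c n := by
  obtain ⟨c₀, hc₀, h⟩ := hev
  obtain ⟨N, hN⟩ := eventually_atTop.1 h
  have hfin : ∀ N : ℕ, ∃ c, 0 < c ∧ ∀ n < N, P c n := by
    intro N
    induction N with
    | zero => exact ⟨1, one_pos, fun n hn => absurd hn (Nat.not_lt_zero n)⟩
    | succ N ih =>
      obtain ⟨c, hc, hcN⟩ := ih
      obtain ⟨c', hc', hc'N⟩ := hpt N
      refine ⟨min c c', lt_min hc hc', fun n hn => ?_⟩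
      rcases Nat.lt_succ_iff_lt_or_eq.1 hn with h | rfl
      · exact hmono c _ n (lt_min hc hc') (min_le_left _ _) (hcN n h)
      · exact hmono c' _ n (lt_min hc hc') (min_le_right _ _) hc'N
  obtain ⟨c₁, hc₁, h₁⟩ := hfin N
  refine ⟨min c₀ c₁, lt_min hc₀ hc₁, fun n => ?_⟩
  rcases lt_or_ge n N with hn | hn
  · exact hmono c₁ _ n (lt_min hc₀ hc₁) (min_le_right _ _) (h₁ n hn)
  · exact hmono c₀ _ n (lt_min hc₀ hc₁) (min_le_left _ _) (hN n hn)

lemma exists_support_of_mem_BStar {r m q : ℕ} (hq : 1 ≤ q) (hqr : q ≤ r) (hm : 1 ≤ m)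
    {β : Fin r → ℕ} (hβ : β ∈ BStar r m q) :
    ∃ A : Finset (Fin r), A.card = q ∧ (∀ i ∈ A, β i = order β) ∧ (∀ i ∉ A, β i = 0) ∧
      order β < m := by
  rcases hβ with h | ⟨b, hb1, hbm, hb, hcard⟩
  · have ho : order β = 0 := by
      rw [order, ← Nat.bot_eq_zero, Finset.sup_eq_bot_iff]
      exact fun i _ => h i
    -- For `β = 0` any `q` coordinates will do; `order β < m` then uses `1 ≤ m`.
    obtain ⟨A, -, hA⟩ := Finset.exists_subset_card_eq
      (show q ≤ (Finset.univ : Finset (Fin r)).card by simpa using hqr)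
    exact ⟨A, hA, fun i _ => by rw [ho, h i], fun i _ => h i, by omega⟩
  · obtain ⟨i₀, hi₀⟩ : (Finset.univ.filter fun i => 0 < β i).Nonempty :=
      Finset.card_pos.1 (by omega)
    have hval : ∀ i, 0 < β i → β i = b := fun i hi => (hb i).resolve_left hi.ne'
    have ho : order β = b := by
      refine le_antisymm (Finset.sup_le fun i _ => ?_) ?_
      · rcases hb i with h | h <;> omega
      · rw [← hval i₀ (Finset.mem_filter.1 hi₀).2]
        exact Finset.le_sup (Finset.mem_univ i₀)
    refine ⟨_, hcard, fun i hi => ?_, fun i hi => ?_, by omega⟩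
    · rw [ho, hval i (Finset.mem_filter.1 hi).2]
    · by_contra h
      exact hi (Finset.mem_filter.2 ⟨Finset.mem_univ i, Nat.pos_of_ne_zero h⟩)

end

end SSANOVA

theorem theorem3 (r q m : ℕ) (hq : 1 ≤ q) (hqr : q ≤ r) (hm : 1 ≤ m)
    (C Cπ σ Cσ : ℝ) (hC : 0 < C) (hCπ : 1 ≤ Cπ) (hσ : 0 < σ) (hCσ : 0 < Cσ)
    (hgauss : ∃ τ : ℝ, 0 < τ ∧ τ ≤ σ ∧ Cσ⁻¹ ≤ τ ^ 2 ∧ τ ^ 2 ≤ Cσ ^ 2 ∧ 3 * τ ^ 4 ≤ Cσ ^ 4)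
    (β : Fin r → ℕ) (hβ : β ∈ SSANOVA.BStar r m q) :
    ∃ c : ℝ, 0 < c ∧ ∀ n : ℕ, 1 ≤ n →
      ENNReal.ofReal (c * ((n : ℝ) / Real.log n ^ (q - 1)) ^
          (-(2 * ((m : ℝ) - SSANOVA.order β) / (2 * m + 1)))) ≤
        SSANOVA.minimaxRisk m q C Cπ σ Cσ β n := by
  obtain ⟨τ, hτ, hτσ, h1, h2, h4⟩ := hgauss
  obtain ⟨A, hA, hβA, hβ0, hord⟩ := SSANOVA.exists_support_of_mem_BStar hq hqr hm hβ
  obtain ⟨c₁, hc₁, hrisk⟩ := SSANOVA.exists_minimaxRisk_ge_dyadic (m := m) hq hC hCπ hCσ hτ hτσ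
    h1 h2 h4 hA hβA hβ0
  have hnonneg : ∀ n : ℕ, 0 ≤ ((n : ℝ) / Real.log n ^ (q - 1)) ^
      (-(2 * ((m : ℝ) - SSANOVA.order β) / (2 * m + 1))) := fun n =>
    Real.rpow_nonneg (div_nonneg n.cast_nonneg (pow_nonneg (Real.log_natCast_nonneg n) _)) _
  refine SSANOVA.exists_const_forall_of_eventually (P := fun c n => 1 ≤ n →
    ENNReal.ofReal (c * ((n : ℝ) / Real.log n ^ (q - 1)) ^
      (-(2 * ((m : ℝ) - SSANOVA.order β) / (2 * m + 1)))) ≤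
        SSANOVA.minimaxRisk m q C Cπ σ Cσ β n) ?_ ?_ ?_
  · intro c c' n _ hcc' hP hn
    refine le_trans (ENNReal.ofReal_le_ofReal ?_) (hP hn)
    exact mul_le_mul_of_nonneg_right hcc' (hnonneg n)
  · intro n
    rcases Nat.eq_zero_or_pos n with rfl | hn
    · exact ⟨1, one_pos, fun h => absurd h (by norm_num)⟩
    have hn0 : (0 : ℝ) < n := by exact_mod_cast hn
    -- For a single `n` the scale `k = 0` suffices: it gives the positive bound `c₁ / n`.
    have h := hrisk n hn 0
    have hn1 : (1 : ℝ) / n ≤ 1 := by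
      rw [div_le_one hn0]
      exact_mod_cast hn
    simp only [pow_zero, one_pow, Nat.zero_div, Nat.cast_zero, zero_add, one_mul, div_one,
      min_eq_left hn1] at h
    set w := ((n : ℝ) / Real.log n ^ (q - 1)) ^
      (-(2 * ((m : ℝ) - SSANOVA.order β) / (2 * m + 1)))
    have hw : 0 ≤ w := hnonneg n
    -- For `n = 1` and `q ≥ 2` the base of the power is `1 / 0 = 0` and `w = 0`; dividing by `w + 1`
    -- covers this case too.
    refine ⟨c₁ * (1 / n) / (w + 1), by positivity, fun _ => le_trans
      (ENNReal.ofReal_le_ofReal ?_) h⟩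
    rw [div_mul_eq_mul_div, div_le_iff₀ (by positivity)]
    gcongr
    linarith
  · obtain ⟨c₂, hc₂, hrate⟩ := SSANOVA.exists_scale_rate hq hord
    refine ⟨c₁ * c₂, by positivity, ?_⟩
    filter_upwards [hrate] with n hn hn1
    obtain ⟨k, hk⟩ := hn
    refine le_trans (ENNReal.ofReal_le_ofReal ?_) (hrisk n hn1 k)
    rw [mul_assoc]
    gcongr
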